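/- All semigroups are nonempty. Let $\mathbf H$ be a pseudovariety of groups, let $\sigma$ be an implicit signature, and let $\mathbf V=\mathbf{DO}\cap\overline{\mathbf H}$ be the class of all finite semigroups in which every regular $\mathcal J$-class is a subsemigroup that is a direct product of a rectangular band by a group, and all of whose subgroups lie in $\mathbf H$. If $\mathbf H$ is $\sigma$-reducible for the pointlike problem, then $\mathbf V$ is $(\sigma\cup\{\_^\omega\})$-reducible for the pointlike problem. Here the following terminology is used. For a finite set $A$, $\overline{\Omega}_A\mathbf S$ denotes the free profinite semigroup on $A$; its elements are called pseudowords, and they have a natural interpretation as $A$-ary operations on every profinite semigroup. For a class $\mathbf W$ of finite semigroups which is a pseudovariety, $p_{\mathbf W}:\overline{\Omega}_A\mathbf S\to\overline{\Omega}_A\mathbf W$ is the canonical projection onto the relatively free pro-$\mathbf W$ semigroup. An implicit signature is a set of pseudowords over finite alphabets that contains the binary multiplication; $\_^\omega$ is the unary operation that maps each element $s$ of a finite semigroup to its unique idempotent power $s^\omega$. The $\sigma$-subalgebra of $\overline{\Omega}_A\mathbf S$ generated by $A$ is denoted $\Omega^\sigma_A\mathbf S$. A subset $P$ of a finite semigroup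 $S$ is $\mathbf W$-pointlike if, for every finite set $A$ and every onto continuous homomorphism $\varphi:\overline{\Omega}_A\mathbf S\to S$, there is a subset $P'$ of $\overline{\Omega}_A\mathbf S$ such that $\varphi(P')=P$ and $p_{\mathbf W}(P')$ is a singleton. Finally, $\mathbf W$ is $\sigma$-reducible for the pointlike problem if, for every finite semigroup $S$, every $\mathbf W$-pointlike subset $P$ of $S$, every finite set $A$ and every onto continuous homomorphism $\varphi:\overline{\Omega}_A\mathbf S\to S$, such a set $P'$ can be chosen inside $\Omega^\sigma_A\mathbf S$. -/

import Mathlib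

open Topology

/-- A class of finite semigroups (semigroups are nonempty, as usual). Every finite semigroup has an
isomorphic copy in `Type`, and the classes that matter are closed under isomorphism. -/
abbrev SemigroupClass : Type 1 :=
  (S : Type) → [Semigroup S] → [Finite S] → [Nonempty S] → Prop

/-- The class of all finite semigroups. -/
def allFiniteSemigroups : SemigroupClass := fun _ => True

/-- A pseudovariety of semigroups: a class of finite semigroups that is closed under finite direct
products (including the empty one), (nonempty) subsemigroups and homomorphic images. -/
structure IsPseudovariety (V : SemigroupClass) : Prop where
  unit : V PUnit
  prod : ∀ (S T : Type) [Semigroup S] [Finite S] [Nonempty S] [Semigroup T] [Finite T] [Nonempty T],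
    V S → V T → V (S × T)
  sub : ∀ (S T : Type) [Semigroup S] [Finite S] [Nonempty S] [Semigroup T] [Finite T] [Nonempty T]
    (i : T →ₙ* S), Function.Injective i → V S → V T
  quot : ∀ (S T : Type) [Semigroup S] [Finite S] [Nonempty S] [Semigroup T] [Finite T] [Nonempty T]
    (q : S →ₙ* T), Function.Surjective q → V S → V T

/-- The semigroup `S` is a group. -/
def IsGroupSemigroup (S : Type) [Semigroup S] : Prop :=
  ∃ e : S, (∀ x, e * x = x ∧ x * e = x) ∧ ∀ x, ∃ y, x * y = e ∧ y * x = e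

/-- A pseudovariety of groups: a pseudovariety of semigroups all of whose members are groups. -/
structure IsGroupPseudovariety (H : SemigroupClass) : Prop where
  isPseudovariety : IsPseudovariety H
  isGroup : ∀ (S : Type) [Semigroup S] [Finite S] [Nonempty S], H S → IsGroupSemigroup S

/-! ### The pseudovarieties `DO` and `H̄` -/

/-- The class `H̄` of all finite semigroups all of whose subgroups (subsemigroups that are groups)
lie in `H`. -/
def barClass (H : SemigroupClass) : SemigroupClass := fun S =>
  ∀ (T : Subsemigroup S) [Nonempty T], IsGroupSemigroup T → H T

/-- The quasi-order `x ≤ y` of Green's relation `J`: `x` lies in `S¹ y S¹`. -/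
def JLE {S : Type} [Semigroup S] (x y : S) : Prop :=
  ∃ a b : WithOne S, (x : WithOne S) = a * y * b

/-- The `J`-class of `x`. -/
def jClass {S : Type} [Semigroup S] (x : S) : Set S := {y | JLE x y ∧ JLE y x}

/-- `x` is a regular element. -/
def IsRegularElement {S : Type} [Semigroup S] (x : S) : Prop := ∃ y, x * y * x = x

/-- `B` is a rectangular band. -/
def IsRectangularBand (B : Type) [Semigroup B] : Prop :=
  (∀ x : B, x * x = x) ∧ ∀ x y : B, x * y * x = x

/-- `T` is a direct product of a rectangular band by a group. -/
def IsRectangularGroup (T : Type) [Semigroup T] : Prop :=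
  ∃ (B G : Type) (_ : Semigroup B) (_ : Semigroup G),
    IsRectangularBand B ∧ IsGroupSemigroup G ∧ Nonempty (T ≃* B × G)

/-- The class `DO` of all finite semigroups in which every regular `J`-class is a subsemigroup
which is a product of a rectangular band by a group. -/
def classDO : SemigroupClass := fun S =>
  ∀ x : S, IsRegularElement x →
    ∃ T : Subsemigroup S, (T : Set S) = jClass x ∧ IsRectangularGroup T

/-- The class `DO ∩ H̄`. -/
def classDOBar (H : SemigroupClass) : SemigroupClass := fun S => classDO S ∧ barClass H S

/-! ### Pseudowords -/

/-- The relatively free pro-`V` semigroup on `A` (for `A` finite), realised as the semigroup of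
`A`-ary implicit operations over `V`: families of maps `(A → S) → S`, for `S` in `V`, which commute
with all homomorphisms between members of `V`. -/
@[ext]
structure ImplicitOp (V : SemigroupClass) (A : Type) : Type 1 where
  eval : ∀ (S : Type) [Semigroup S] [Finite S] [Nonempty S], V S → (A → S) → S
  natural : ∀ (S T : Type) [Semigroup S] [Finite S] [Nonempty S]
    [Semigroup T] [Finite T] [Nonempty T] (hS : V S) (hT : V T) (g : S →ₙ* T) (f : A → S),
    g (eval S hS f) = eval T hT (fun a => g (f a))

namespace ImplicitOp

/-- Implicit operations are multiplied pointwise. -/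
instance (V : SemigroupClass) (A : Type) : Semigroup (ImplicitOp V A) where
  mul u v :=
    { eval := fun S _ _ _ hS f => u.eval S hS f * v.eval S hS f
      natural := by
        intro S T _ _ _ _ _ _ hS hT g f
        rw [map_mul, u.natural S T hS hT g f, v.natural S T hS hT g f] }
  mul_assoc u v w := by
    apply ImplicitOp.ext
    funext S _ _ _ hS f
    exact mul_assoc _ _ _

/-- The profinite topology: the coarsest one for which all evaluations in (discrete) members of `V`
are continuous. -/
instance (V : SemigroupClass) (A : Type) : TopologicalSpace (ImplicitOp V A) :=
  ⨅ (S : Type) (_ : Semigroup S) (_ : Finite S) (_ : Nonempty S) (hS : V S) (f : A → S),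
    TopologicalSpace.induced (fun u : ImplicitOp V A => u.eval S hS f) ⊥

end ImplicitOp

/-- The free profinite semigroup on `A`; its elements are the pseudowords over `A`. -/
abbrev FreeProfinite (A : Type) : Type 1 := ImplicitOp allFiniteSemigroups A

/-- The generator `a` as a pseudoword. -/
def FreeProfinite.of {A : Type} (a : A) : FreeProfinite A where
  eval := fun _ _ _ _ _ f => f a
  natural := by intros; rfl

/-- The canonical projection of the free profinite semigroup onto the relatively free pro-`V`
semigroup. -/
def FreeProfinite.proj (V : SemigroupClass) {A : Type} (u : FreeProfinite A) : ImplicitOp V A where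
  eval := fun S _ _ _ _ f => u.eval S trivial f
  natural := by
    intro S T _ _ _ _ _ _ _ _ g f
    exact u.natural S T trivial trivial g f

/-- The natural interpretation of the pseudoword `w`, as an operation of arity `B`, in the free
profinite semigroup on `A`. -/
def FreeProfinite.subst {A B : Type} (w : FreeProfinite B) (v : B → FreeProfinite A) :
    FreeProfinite A where
  eval := fun S _ _ _ hS f => w.eval S hS (fun b => (v b).eval S hS f)
  natural := by
    intro S T _ _ _ _ _ _ hS hT g f
    rw [w.natural S T hS hT g]
    congr 1
    funext b
    exact (v b).natural S T hS hT g f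

/-! ### The `ω`-power -/

/-- `powSucc x n` is the power of `x` with exponent `n + 1`. -/
def powSucc {S : Type} [Semigroup S] (x : S) : ℕ → S
  | 0 => x
  | n + 1 => powSucc x n * x

/-- `e` is an idempotent power of `x`. -/
def IsIdempotentPower {S : Type} [Semigroup S] (x e : S) : Prop :=
  e * e = e ∧ ∃ n, e = powSucc x n

theorem coe_powSucc {S : Type} [Semigroup S] (x : S) (n : ℕ) :
    ((powSucc x n : S) : WithOne S) = (x : WithOne S) ^ (n + 1) := by
  induction n with
  | zero => simp [powSucc]
  | succ n ih => rw [powSucc, WithOne.coe_mul, ih, ← pow_succ]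

theorem exists_isIdempotentPower {S : Type} [Semigroup S] [Finite S] (x : S) :
    ∃ e, IsIdempotentPower x e := by
  obtain ⟨i, j, hne, hij⟩ := Finite.exists_ne_map_eq_of_infinite (powSucc x)
  wlog hlt : i < j generalizing i j
  · exact this j i hne.symm hij.symm (by omega)
  obtain ⟨d, rfl⟩ := Nat.exists_eq_add_of_lt hlt
  have h0 : (x : WithOne S) ^ (i + 1) = (x : WithOne S) ^ (i + 1 + (d + 1)) := by
    rw [← coe_powSucc, hij, coe_powSucc]
    congr 1
    omega
  have h1 : ∀ k m : ℕ, (x : WithOne S) ^ (i + 1 + m) =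
      (x : WithOne S) ^ (i + 1 + m + k * (d + 1)) := by
    intro k m
    induction k with
    | zero => simp
    | succ k ih =>
      calc (x : WithOne S) ^ (i + 1 + m) = (x : WithOne S) ^ (i + 1 + m + k * (d + 1)) := ih
        _ = (x : WithOne S) ^ (i + 1) * (x : WithOne S) ^ (m + k * (d + 1)) := by
            rw [← pow_add, Nat.add_assoc (i + 1)]
        _ = (x : WithOne S) ^ (i + 1 + m + (k + 1) * (d + 1)) := by
            rw [h0, ← pow_add]
            congr 1
            ring
  have hN : (i + 1) * (d + 1) = i + 1 + (i + 1) * d := by ring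
  refine ⟨powSucc x ((i + 1) * (d + 1) - 1), ?_, _, rfl⟩
  have hpos : 0 < (i + 1) * (d + 1) := by positivity
  have hc : ((powSucc x ((i + 1) * (d + 1) - 1) : S) : WithOne S) =
      (x : WithOne S) ^ ((i + 1) * (d + 1)) := by
    rw [coe_powSucc, Nat.sub_add_cancel hpos]
  apply WithOne.coe_injective
  rw [WithOne.coe_mul, hc, ← pow_add]
  have := h1 (i + 1) ((i + 1) * d)
  rw [← hN] at this
  exact this.symm

theorem IsIdempotentPower.unique {S : Type} [Semigroup S] {x e f : S}
    (he : IsIdempotentPower x e) (hf : IsIdempotentPower x f) : e = f := by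
  obtain ⟨he, m, hm⟩ := he
  obtain ⟨hf, n, hn⟩ := hf
  have key : ∀ (g : S), g * g = g → ∀ k : ℕ, (g : WithOne S) ^ (k + 1) = g := by
    intro g hg k
    induction k with
    | zero => simp
    | succ k ih => rw [pow_succ, ih, ← WithOne.coe_mul, hg]
  apply WithOne.coe_injective
  rw [← key e he n, ← key f hf m, hm, hn, coe_powSucc, coe_powSucc, ← pow_mul, ← pow_mul,
    mul_comm]

theorem IsIdempotentPower.map {S T : Type} [Semigroup S] [Semigroup T] (g : S →ₙ* T) {x e : S}
    (he : IsIdempotentPower x e) : IsIdempotentPower (g x) (g e) := by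
  obtain ⟨he, n, rfl⟩ := he
  refine ⟨by rw [← map_mul, he], n, ?_⟩
  clear he
  induction n with
  | zero => rfl
  | succ n ih => rw [powSucc, map_mul, ih, powSucc]

/-- The `ω`-power in a finite semigroup: the unique idempotent power. -/
noncomputable def omegaPow {S : Type} [Semigroup S] [Finite S] (x : S) : S :=
  (exists_isIdempotentPower x).choose

theorem omegaPow_spec {S : Type} [Semigroup S] [Finite S] (x : S) :
    IsIdempotentPower x (omegaPow x) :=
  (exists_isIdempotentPower x).choose_spec

/-- The unary implicit operation `x ↦ x ^ ω`. -/
noncomputable def omegaOp : FreeProfinite (Fin 1) where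
  eval := fun _ _ _ _ _ f => omegaPow (f 0)
  natural := by
    intro S T _ _ _ _ _ _ _ _ g f
    exact ((omegaPow_spec (f 0)).map g).unique (omegaPow_spec (g (f 0)))

/-! ### Implicit signatures and reducibility -/

/-- An implicit signature: a set of pseudowords over finite alphabets, one of which is the binary
multiplication. -/
structure ImplicitSignature : Type 1 where
  ops : Set (Σ n : ℕ, FreeProfinite (Fin n))
  mul_mem : ⟨2, FreeProfinite.of 0 * FreeProfinite.of 1⟩ ∈ ops

/-- The signature `σ ∪ {_^ω}`. -/
noncomputable def ImplicitSignature.adjoinOmega (σ : ImplicitSignature) : ImplicitSignature where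
  ops := σ.ops ∪ {⟨1, omegaOp⟩}
  mul_mem := Or.inl σ.mul_mem

/-- Membership in the `σ`-subalgebra of the free profinite semigroup on `A` generated by `A`. -/
inductive ImplicitSignature.IsTerm (σ : ImplicitSignature) {A : Type} : FreeProfinite A → Prop
  | of (a : A) : IsTerm σ (FreeProfinite.of a)
  | op {n : ℕ} (w : FreeProfinite (Fin n)) (hw : ⟨n, w⟩ ∈ σ.ops) (v : Fin n → FreeProfinite A)
      (hv : ∀ i, IsTerm σ (v i)) : IsTerm σ (w.subst v)

/-- The `σ`-subalgebra of the free profinite semigroup on `A` generated by `A`. -/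
def ImplicitSignature.subalgebra (σ : ImplicitSignature) (A : Type) : Set (FreeProfinite A) :=
  {u | σ.IsTerm u}

/-- `P'` witnesses, with respect to `φ`, that `P` is `V`-pointlike: `φ` maps `P'` onto `P` and the
projection of `P'` to the relatively free pro-`V` semigroup is a singleton. -/
def IsPointlikeWitness (V : SemigroupClass) {S A : Type} [Semigroup S] (φ : FreeProfinite A →ₙ* S)
    (P : Set S) (P' : Set (FreeProfinite A)) : Prop :=
  φ '' P' = P ∧ ∃ q : ImplicitOp V A, FreeProfinite.proj V '' P' = {q}

/-- `P` is a `V`-pointlike subset of the finite (discrete) semigroup `S`. -/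
def IsPointlike (V : SemigroupClass) {S : Type} [Semigroup S] (P : Set S) : Prop :=
  ∀ (A : Type) [Finite A] (φ : FreeProfinite A →ₙ* S), Continuous[_, ⊥] φ →
    Function.Surjective φ → ∃ P' : Set (FreeProfinite A), IsPointlikeWitness V φ P P'

/-- `V` is `σ`-reducible for the pointlike problem: the witnesses for `V`-pointlike subsets of
finite semigroups can always be chosen inside the `σ`-subalgebra generated by the alphabet. -/
def IsReducibleForPointlikes (V : SemigroupClass) (σ : ImplicitSignature) : Prop :=
  ∀ (S : Type) [Semigroup S] [Finite S] [Nonempty S] (P : Set S), IsPointlike V P →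
    ∀ (A : Type) [Finite A] (φ : FreeProfinite A →ₙ* S), Continuous[_, ⊥] φ →
      Function.Surjective φ →
        ∃ P' : Set (FreeProfinite A), P' ⊆ σ.subalgebra A ∧ IsPointlikeWitness V φ P P'

/-! ### Rectangular groups -/

/-! Write `V` for `DO ∩ H̄`. The core is a statement on families (`replaceable_of_agreeOn`): if
finitely many pseudowords `u i` agree over `V`, then some `(σ ∪ {ω})`-terms `w i` agree over `V` and
have the same values in `S`. Beforehand `S` is enlarged so that a value determines the content.

Two facts about `V` carry the proof. First, cutting at the first or last occurrence of a letter
respects equality over `V` (`AgreeOn.cutEval_eq`), because the cut words over a monoid in `V` form a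
monoid in `V` (`classDOBar.cutWord`). Second, if `e` and `f` have the same content and it contains
that of `t`, then over `V` the product `e^ω t f^ω` depends on `t` only through its value over `H`
(`AgreeOn.omega_mul_mul_omega`): in a member of `DO` the elements `J`-above an idempotent `e` form a
subsemigroup, on which `x ↦ e x e` is a homomorphism into a group, and this group is in `H`.

The induction is on a set `B` of letters containing all contents. Prefixes of content `B` are cut
off from the left; they are products of letters and of pieces missing a letter of `B`, hence
replaceable by induction. If some remainder is replaceable, so is the family. Otherwise the process
never stops, and by the pigeonhole principle the values satisfy `u = p e^k r` for every `k`
(`exists_factor_pow`). Dually `r = z f^l q` unless `r` is replaceable. The middle `z` is replaced by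
`σ`-terms `t` that agree over `H`, by reducibility of `H`, and `p' e'^ω t f'^ω q'` is the required
family: its values are right since `ω`-powers are powers, and it agrees over `V` by the second fact.
-/

theorem IsRectangularBand.mul_mul_eq {B : Type} [Semigroup B] (hB : IsRectangularBand B)
    (x y z : B) : x * y * z = x * z := by
  have h1 := hB.2 x (y * z)
  have h2 := hB.2 z x
  calc x * y * z = x * y * (z * x * z) := by rw [h2]
    _ = x * (y * z) * x * z := by simp only [mul_assoc]
    _ = x * z := by rw [h1]

/-- An idempotent has trivial group coordinate, and inner factors vanish in the band coordinate. -/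
theorem IsRectangularGroup.mul_idem_mul {T : Type} [Semigroup T] (hT : IsRectangularGroup T)
    {e : T} (he : e * e = e) (a b : T) : a * e * b = a * b := by
  obtain ⟨B, G, _, _, hB, ⟨o, ho, hinv⟩, ⟨φ⟩⟩ := hT
  apply φ.injective
  have hφ : φ e * φ e = φ e := by rw [← map_mul, he]
  have h2 : (φ e).2 = o := by
    obtain ⟨y, hy, -⟩ := hinv (φ e).2
    have : (φ e).2 * (φ e).2 = (φ e).2 := congrArg Prod.snd hφ
    calc (φ e).2 = (φ e).2 * o := ((ho _).2).symm
      _ = (φ e).2 * (φ e).2 * y := by rw [mul_assoc, hy]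
      _ = o := by rw [this, hy]
  simp only [map_mul]
  ext
  · exact hB.mul_mul_eq _ _ _
  · simp only [Prod.snd_mul, h2, (ho _).2]

theorem IsRectangularGroup.exists_inv {T : Type} [Semigroup T] (hT : IsRectangularGroup T)
    {e : T} (he : e * e = e) (a : T) :
    ∃ y, e * y = y ∧ y * e = y ∧ e * a * e * y = e ∧ y * (e * a * e) = e := by
  have key := fun a b => hT.mul_idem_mul he a b
  obtain ⟨B, G, _, _, hB, ⟨o, ho, hinv⟩, ⟨φ⟩⟩ := hT
  obtain ⟨y, hy⟩ : ∃ y, e * a * y * e = e ∧ e * y * a * e = e := by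
    obtain ⟨z, hz1, hz2⟩ := hinv (φ a).2
    have hs : (φ e).2 * (φ e).2 = (φ e).2 := by rw [← Prod.snd_mul, ← map_mul, he]
    -- Only the group coordinate `z` matters: the frame by `e` absorbs any band coordinate.
    refine ⟨φ.symm ((φ a).1, z), ?_, ?_⟩
    all_goals
      apply φ.injective
      ext
      · simp only [map_mul, Prod.fst_mul, hB.mul_mul_eq, hB.1, MulEquiv.apply_symm_apply]
      · have h1 : (φ e).2 * (φ a).2 * z * (φ e).2 = (φ e).2 := by
          rw [mul_assoc _ _ z, hz1, (ho _).2, hs]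
        have h2 : (φ e).2 * z * (φ a).2 * (φ e).2 = (φ e).2 := by
          rw [mul_assoc _ z, hz2, (ho _).2, hs]
        simp only [map_mul, Prod.snd_mul, MulEquiv.apply_symm_apply, h1, h2]
  refine ⟨e * y * e, ?_, ?_, ?_, ?_⟩
  · simp only [← mul_assoc, he]
  · simp only [mul_assoc, he]
  · simp only [← mul_assoc, key]; exact hy.1
  · simp only [← mul_assoc, key]; exact hy.2

/-- Every element lies in a subgroup, with identity `idm x`. The idempotents form a rectangular band
`B`; for a fixed idempotent `ε`, the set `G = εTε` is a group. The isomorphism is `x ↦ (idm x, ε x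
ε)`, with inverse `(b, g) ↦ b g b`. -/
theorem isRectangularGroup_of_exists_inv {T : Type} [Semigroup T] [Nonempty T]
    (hinv : ∀ x : T, ∃ y e, e * e = e ∧ e * x = x ∧ x * e = x ∧ x * y = e ∧ y * x = e)
    (hband : ∀ e f : T, e * e = e → f * f = f → e * f * e = e) : IsRectangularGroup T := by
  have rect : ∀ e f g : T, e * e = e → f * f = f → g * g = g → e * f * g = e * g := by
    intro e f g he hf hg
    have hfg : f * g * (f * g) = f * g := by
      rw [← mul_assoc, hband f g hf hg]
    calc e * f * g = e * f * (g * e * g) := by rw [hband g e hg he]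
      _ = e * (f * g) * e * g := by simp only [mul_assoc]
      _ = e * g := by rw [hband e _ he hfg]
  choose inv idm h1 h2 h3 h4 h5 using hinv
  have uniq : ∀ x e : T, e * e = e → e * idm x = idm x → idm x * e = idm x → idm x = e := by
    intro x e he ha hb
    rw [← ha, ← hb, ← mul_assoc, hband e _ he (h1 x)]
  have idm_mul : ∀ x y, idm (x * y) = idm x * idm y := by
    intro x y
    have ha : idm x * idm (x * y) = idm (x * y) := by
      rw [← h4 (x * y), ← mul_assoc, ← mul_assoc, h2]
    have hb : idm (x * y) * idm y = idm (x * y) := by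
      rw [← h5 (x * y), mul_assoc, mul_assoc, h3]
    rw [← hb, ← ha]
    exact rect _ _ _ (h1 _) (h1 _) (h1 _)
  have idm_idem : ∀ e, e * e = e → idm e = e := fun e he =>
    uniq e e he (by nth_rw 1 [← h4 e]; rw [← mul_assoc, he, h4])
      (by nth_rw 1 [← h5 e]; rw [mul_assoc, he, h5])
  obtain ⟨t⟩ := ‹Nonempty T›
  obtain ⟨ε, hε⟩ : ∃ ε : T, ε * ε = ε := ⟨idm t, h1 t⟩
  -- `ε` can be deleted anywhere, since it stands between the idempotents `idm x` and `idm y`.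
  have mid : ∀ x y, x * ε * y = x * y := by
    intro x y
    calc x * ε * y = x * idm x * ε * (idm y * y) := by rw [h3, h2]
      _ = x * (idm x * ε * idm y) * y := by simp only [mul_assoc]
      _ = x * y := by rw [rect _ _ _ (h1 _) hε (h1 _), ← mul_assoc, h3, mul_assoc, h2]
  let B : Subsemigroup T :=
    { carrier := {e | e * e = e}
      mul_mem' := by
        intro e f he hf
        change e * f * (e * f) = e * f
        rw [← mul_assoc, hband e f he hf] }
  let G : Subsemigroup T :=
    { carrier := {x | ε * x = x ∧ x * ε = x}
      mul_mem' := by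
        intro x y hx hy
        exact ⟨by rw [← mul_assoc, hx.1], by rw [mul_assoc, hy.2]⟩ }
  have hεG : ∀ x, ε * x * ε ∈ G := fun x =>
    ⟨by rw [← mul_assoc, ← mul_assoc, hε], by rw [mul_assoc, hε]⟩
  refine ⟨B, G, inferInstance, inferInstance, ⟨fun x => Subtype.ext x.2, fun x y => Subtype.ext
    (hband _ _ x.2 y.2)⟩, ⟨⟨ε, hε, hε⟩, fun x => ⟨Subtype.ext x.2.1, Subtype.ext x.2.2⟩, ?_⟩, ?_⟩
  · rintro ⟨x, hx1, hx2⟩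
    have hi : idm x = ε := uniq x ε hε (by nth_rw 1 [← h4 x]; rw [← mul_assoc, hx1, h4])
      (by nth_rw 1 [← h5 x]; rw [mul_assoc, hx2, h5])
    refine ⟨⟨_, hεG (inv x)⟩, Subtype.ext ?_, Subtype.ext ?_⟩
    · change x * (ε * inv x * ε) = ε
      rw [← mul_assoc, ← mul_assoc, mid, h4, hi, hε]
    · change ε * inv x * ε * x = ε
      rw [mid, mul_assoc, h5, hi, hε]
  · refine ⟨MulEquiv.ofBijective
      (⟨fun x => (⟨idm x, h1 x⟩, ⟨ε * x * ε, hεG x⟩), ?_⟩ : T →ₙ* B × G) ⟨?_, ?_⟩⟩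
    · intro x y
      refine Prod.ext (Subtype.ext (idm_mul x y)) (Subtype.ext ?_)
      change ε * (x * y) * ε = ε * x * ε * (ε * y * ε)
      simp only [← mul_assoc, mid]
    · intro x y hxy
      have e1 : idm x = idm y := congrArg (fun p => (p.1 : T)) hxy
      have e2 : ε * x * ε = ε * y * ε := congrArg (fun p => (p.2 : T)) hxy
      calc x = idm x * (ε * x * ε) * idm x := by simp only [← mul_assoc, mid, h2, h3]
        _ = idm y * (ε * y * ε) * idm y := by rw [e1, e2]
        _ = y := by simp only [← mul_assoc, mid, h2, h3]
    · rintro ⟨⟨b, hb⟩, ⟨g, hg1, hg2⟩⟩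
      have hb : b * b = b := hb
      refine ⟨b * g * b, Prod.ext (Subtype.ext ?_) (Subtype.ext ?_)⟩
      · change idm (b * g * b) = b
        rw [idm_mul, idm_mul, idm_idem b hb]
        exact hband b _ hb (h1 _)
      · change ε * (b * g * b) * ε = g
        have : ε * b * ε = ε := hband ε b hε hb
        calc ε * (b * g * b) * ε = ε * b * (ε * g * ε) * b * ε := by
              rw [hg1, hg2]; simp only [mul_assoc]
          _ = (ε * b * ε) * g * (ε * b * ε) := by simp only [mul_assoc]
          _ = g := by rw [this, hg1, hg2]

/-! ### The `J`-order -/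

section JOrder

variable {S : Type} [Semigroup S]

theorem JLE.refl (x : S) : JLE x x := ⟨1, 1, by simp⟩

theorem JLE.trans {x y z : S} (h : JLE x y) (h' : JLE y z) : JLE x z := by
  obtain ⟨a, b, h⟩ := h
  obtain ⟨c, d, h'⟩ := h'
  exact ⟨a * c, d * b, by rw [h, h']; simp only [mul_assoc]⟩

theorem JLE.of_eq {x y p q : S} (h : x = p * y * q) : JLE x y := ⟨p, q, by rw [h]; simp⟩

theorem jle_mul_left (x y : S) : JLE (x * y) x := ⟨1, y, by simp⟩

theorem jle_mul_right (x y : S) : JLE (x * y) y := ⟨x, 1, by simp⟩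

/-- Replacing the multipliers `a`, `b` by `x a`, `b x` brings them from `S¹` into `S`. -/
theorem JLE.exists_mul {x y : S} (h : JLE x y) (hx : x * x = x) :
    ∃ p q, x * p = p ∧ q * x = q ∧ p * y * q = x := by
  obtain ⟨a, b, h⟩ := h
  obtain ⟨p, hp⟩ : ∃ p : S, (p : WithOne S) = x * a := by
    induction a with
    | one => exact ⟨x, by simp⟩
    | coe a => exact ⟨x * a, by simp⟩
  obtain ⟨q, hq⟩ : ∃ q : S, (q : WithOne S) = b * x := by
    induction b with
    | one => exact ⟨x, by simp⟩
    | coe b => exact ⟨b * x, by simp⟩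
  have hx' : (x : WithOne S) * x = x := by rw [← WithOne.coe_mul, hx]
  refine ⟨p, q, ?_, ?_, ?_⟩ <;> apply WithOne.coe_injective <;>
    simp only [WithOne.coe_mul, hp, hq]
  · rw [← mul_assoc, hx']
  · rw [mul_assoc, hx']
  · calc (x : WithOne S) * a * y * (b * x) = x * (a * y * b) * x := by simp only [mul_assoc]
      _ = x := by rw [← h, hx', hx']

/-- Idempotents absorb, in the sense `e f e = e`, the idempotents which are `J`-above them. -/
def AbsorbsIdempotents (S : Type) [Semigroup S] : Prop :=
  ∀ e f : S, e * e = e → f * f = f → JLE e f → e * f * e = e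

/-! ### The condition `e f e = e` as a workable characterization of `DO`. -/

namespace AbsorbsIdempotents

/-- If `e = p y q`, then `y q p` is an idempotent `J`-above `e`, so `e` absorbs it and `z = q p e`
satisfies `e y z = e`. Then `z y` is again an idempotent `J`-above `e`, and absorbing it gives the
last equation. -/
theorem exists_idem_right (hS : AbsorbsIdempotents S) {e y : S} (he : e * e = e) (h : JLE e y) :
    ∃ z, z * e = z ∧ e * y * z = e ∧ z * y * (z * y) = z * y ∧ e * z * y * e = e := by
  obtain ⟨p, q, hp, hq, hpq⟩ := h.exists_mul he
  have h1 : e * (y * q * p) * e = e := by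
    refine hS e _ he ?_ (JLE.of_eq (p := p) (q := y * q) ?_)
    · calc y * q * p * (y * q * p) = y * q * (p * y * q) * p := by simp only [mul_assoc]
        _ = y * q * p := by rw [hpq, mul_assoc, mul_assoc, hp, mul_assoc]
    · calc e = p * y * q * (p * y * q) := by rw [hpq, he]
        _ = _ := by simp only [mul_assoc]
  have hz : e * y * (q * p * e) = e := by simpa only [mul_assoc] using h1
  have hze : q * p * e * e = q * p * e := by rw [mul_assoc, he]
  have hid : q * p * e * y * (q * p * e * y) = q * p * e * y := by
    calc q * p * e * y * (q * p * e * y) = q * p * (e * y * (q * p * e)) * y := by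
          simp only [mul_assoc]
      _ = _ := by rw [hz]
  refine ⟨q * p * e, hze, hz, hid, ?_⟩
  have := hS e _ he hid (JLE.of_eq (p := e * y) (q := q * p * e) ?_)
  · simpa only [mul_assoc] using this
  · calc e = e * y * (q * p * (e * y * (q * p * e))) := by rw [hz, hz]
      _ = _ := by simp only [mul_assoc]

theorem exists_idem_left (hS : AbsorbsIdempotents S) {e y : S} (he : e * e = e) (h : JLE e y) :
    ∃ z, e * z = z ∧ e * y * z * e = e := by
  obtain ⟨p, q, hp, hq, hpq⟩ := h.exists_mul he
  have h1 : e * (q * p * y) * e = e := by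
    refine hS e _ he ?_ (JLE.of_eq (p := p * y) (q := q) ?_)
    · calc q * p * y * (q * p * y) = q * (p * y * q) * p * y := by simp only [mul_assoc]
        _ = q * p * y := by rw [hpq, hq]
    · calc e = p * y * q * (p * y * q) := by rw [hpq, he]
        _ = _ := by simp only [mul_assoc]
  have hz : e * q * p * (y * e) = e := by simpa only [mul_assoc] using h1
  have hze : e * (e * q * p) = e * q * p := by simp only [← mul_assoc, he]
  have hid : y * (e * q * p) * (y * (e * q * p)) = y * (e * q * p) := by
    calc y * (e * q * p) * (y * (e * q * p)) = y * (e * q * p * (y * e)) * q * p := by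
          simp only [mul_assoc]
      _ = _ := by rw [hz]; simp only [mul_assoc]
  refine ⟨e * q * p, hze, ?_⟩
  have := hS e _ he hid (JLE.of_eq (p := e * q * p) (q := y * e) ?_)
  · simpa only [mul_assoc] using this
  · calc e = (e * q * p * (y * e)) * q * p * (y * e) := by rw [hz, hz]
      _ = _ := by simp only [mul_assoc]

/-- The two preceding lemmas give a left and a right inverse of `e y e` in the monoid `eSe`; they
coincide. -/
theorem exists_inv (hS : AbsorbsIdempotents S) {e y : S} (he : e * e = e) (h : JLE e y) :
    ∃ w, e * w = w ∧ w * e = w ∧ e * y * e * w = e ∧ w * (e * y * e) = e := by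
  obtain ⟨z, hz1, -, -, hz2⟩ := hS.exists_idem_right he h
  obtain ⟨v, hv1, hv2⟩ := hS.exists_idem_left he h
  have hl : e * z * (e * y * e) = e := by
    calc e * z * (e * y * e) = e * (z * e) * y * e := by simp only [mul_assoc]
      _ = e := by rw [hz1, hz2]
  have hr : e * y * e * (v * e) = e := by
    calc e * y * e * (v * e) = e * y * (e * v) * e := by simp only [mul_assoc]
      _ = e := by rw [hv1, hv2]
  have hlr : e * z = v * e := by
    calc e * z = e * z * e := by rw [mul_assoc, hz1]
      _ = e * z * (e * y * e) * (v * e) := by rw [mul_assoc (e * z) _ (v * e), hr]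
      _ = v * e := by rw [hl, ← mul_assoc, hv1]
  exact ⟨v * e, by rw [← mul_assoc, hv1], by rw [mul_assoc, he], hr, hlr ▸ hl⟩

/-- With `e x z = e` and `h = z x` idempotent, `h` is `J`-below `y`, so `h y h` is invertible in
`hSh`. Inserting `h = h y h w` into `e = e x h z` exhibits `x y` as a factor of `e`. -/
theorem jle_mul (hS : AbsorbsIdempotents S) {e x y : S} (he : e * e = e) (hx : JLE e x)
    (hy : JLE e y) : JLE e (x * y) := by
  obtain ⟨z, hz1, hz2, hz3, -⟩ := hS.exists_idem_right he hx
  have hh : JLE (z * x) y := by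
    refine JLE.trans ?_ hy
    exact JLE.of_eq (p := z) (q := x) (by rw [hz1])
  obtain ⟨w, -, -, hw, -⟩ := hS.exists_inv hz3 hh
  refine JLE.of_eq (p := e) (q := z * x * w * z) ?_
  have h1 : e * x * (z * x) = e * x := by rw [← mul_assoc, hz2]
  calc e = e * x * (z * x) * z := by rw [h1, hz2]
    _ = e * x * (z * x) * y * (z * x) * w * z := by
        nth_rw 1 [← hw]; simp only [mul_assoc]
    _ = e * (x * y) * (z * x * w * z) := by rw [h1]; simp only [mul_assoc]

end AbsorbsIdempotents

theorem eq_powSucc_mul_mul {y c d : S} (h : y = c * y * d) (n : ℕ) :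
    y = powSucc c n * y * powSucc d n := by
  induction n with
  | zero => exact h
  | succ n ih =>
    have hd : d * powSucc d n = powSucc d n * d := by
      apply WithOne.coe_injective
      simp only [WithOne.coe_mul, coe_powSucc, ← pow_succ, ← pow_succ']
    calc y = powSucc c n * (c * y * d) * powSucc d n := by rw [← h]; exact ih
      _ = powSucc c n * c * y * (d * powSucc d n) := by simp only [mul_assoc]
      _ = _ := by rw [hd]; rfl

theorem jle_powSucc (c : S) (n : ℕ) : JLE (powSucc c n) c := by
  cases n with
  | zero => exact JLE.refl c
  | succ n => exact jle_mul_right _ _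

/-- Factoring `y = p q` through `e` and writing `e = p' y q'` yields `y = (p p') y (q' q)`. By
iteration, the idempotent powers of `p p'` and of `q' q` fix `y` on the left and on the right. -/
theorem exists_idem_fixing [Finite S] {e y : S} (he : e * e = e) (h : y ∈ jClass e) :
    (∃ α ∈ jClass e, α * α = α ∧ α * y = y) ∧ (∃ β ∈ jClass e, β * β = β ∧ y * β = y) := by
  obtain ⟨hey, ⟨P, Q, hPQ⟩⟩ := h
  obtain ⟨p', q', hp', hq', hpq'⟩ := hey.exists_mul he
  obtain ⟨p, hp⟩ : ∃ p : S, (p : WithOne S) = P * e := by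
    induction P with
    | one => exact ⟨e, by simp⟩
    | coe a => exact ⟨a * e, by simp⟩
  obtain ⟨q, hq⟩ : ∃ q : S, (q : WithOne S) = e * Q := by
    induction Q with
    | one => exact ⟨e, by simp⟩
    | coe a => exact ⟨e * a, by simp⟩
  have hee : (e : WithOne S) * e = e := by rw [← WithOne.coe_mul, he]
  have hpe : p * e = p := by
    apply WithOne.coe_injective; rw [WithOne.coe_mul, hp, mul_assoc, hee]
  have heq : e * q = q := by
    apply WithOne.coe_injective; rw [WithOne.coe_mul, hq, ← mul_assoc, hee]
  have hy : y = p * q := by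
    apply WithOne.coe_injective; rw [WithOne.coe_mul, hp, hq, hPQ]
    calc P * e * Q = P * (e * e) * Q := by rw [hee]
      _ = _ := by simp only [mul_assoc]
  have hyy : y = p * p' * y * (q' * q) := by
    calc y = p * (p' * y * q') * q := by rw [hpq', hpe, hy]
      _ = _ := by simp only [mul_assoc]
  constructor
  · obtain ⟨α, hα, n, hn⟩ := exists_isIdempotentPower (p * p')
    have hαy : α * y = y := by
      have := eq_powSucc_mul_mul hyy n
      rw [← hn] at this
      calc α * y = α * (α * y * powSucc (q' * q) n) := by rw [← this]
        _ = α * α * y * powSucc (q' * q) n := by simp only [mul_assoc]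
        _ = y := by rw [hα, ← this]
    refine ⟨α, And.symm ⟨?_, ?_⟩, hα, hαy⟩
    · rw [hn]
      exact (jle_powSucc _ n).trans (JLE.of_eq (p := p) (q := p') (by rw [hpe]))
    · refine hey.trans ?_
      rw [← hαy]
      exact jle_mul_left _ _
  · obtain ⟨β, hβ, n, hn⟩ := exists_isIdempotentPower (q' * q)
    have hβy : y * β = y := by
      have := eq_powSucc_mul_mul hyy n
      rw [← hn] at this
      calc y * β = powSucc (p * p') n * y * β * β := by rw [← this]
        _ = powSucc (p * p') n * y * (β * β) := by simp only [mul_assoc]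
        _ = y := by rw [hβ, ← this]
    refine ⟨β, And.symm ⟨?_, ?_⟩, hβ, hβy⟩
    · rw [hn]
      exact (jle_powSucc _ n).trans (JLE.of_eq (p := q') (q := q) (by rw [hq']))
    · refine hey.trans ?_
      rw [← hβy]
      exact jle_mul_right _ _

theorem AbsorbsIdempotents.classDO [Finite S] [Nonempty S] (hS : AbsorbsIdempotents S) :
    classDO S := by
  rintro x ⟨y, hxyx⟩
  have he : x * y * (x * y) = x * y := by rw [← mul_assoc, hxyx]
  set e := x * y with hedef
  have hxe : JLE x e := by
    nth_rw 1 [← hxyx]; exact jle_mul_left _ _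
  have hex : JLE e x := jle_mul_left _ _
  have hJ : jClass x = jClass e := by
    ext z
    exact ⟨fun h => ⟨hex.trans h.1, h.2.trans hxe⟩, fun h => ⟨hxe.trans h.1, h.2.trans hex⟩⟩
  rw [hJ]
  let T : Subsemigroup S :=
    { carrier := jClass e
      mul_mem' := fun {a b} ha hb => ⟨hS.jle_mul he ha.1 hb.1, (jle_mul_left a b).trans ha.2⟩ }
  have : Nonempty T := ⟨⟨e, JLE.refl e, JLE.refl e⟩⟩
  have band : ∀ f g : S, f ∈ T → g ∈ T → f * f = f → g * g = g → f * g * f = f :=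
    fun f g hf hg hff hgg => hS f g hff hgg (hf.2.trans hg.1)
  refine ⟨T, rfl, isRectangularGroup_of_exists_inv ?_ ?_⟩
  · rintro ⟨y, hy⟩
    obtain ⟨⟨α, hαJ, hα, hαy⟩, ⟨β, hβJ, hβ, hβy⟩⟩ := exists_idem_fixing he hy
    -- The product `α β` is a single idempotent that fixes `y` on both sides, so `y` is invertible
    -- in its local group.
    have hγJ : α * β ∈ T := T.mul_mem hαJ hβJ
    have h1 := band α β hαJ hβJ hα hβ
    have h2 := band β α hβJ hαJ hβ hα
    have hγ : α * β * (α * β) = α * β := by rw [← mul_assoc, h1]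
    have hγy : α * β * y = y := by rw [← hαy, ← mul_assoc, h1]
    have hyγ : y * (α * β) = y := by rw [← hβy, mul_assoc, ← mul_assoc β, h2]
    obtain ⟨w, hw1, hw2, hw3, hw4⟩ := hS.exists_inv hγ (hγJ.2.trans hy.1)
    rw [hγy, hyγ] at hw3 hw4
    refine ⟨⟨w, ?_⟩, ⟨α * β, hγJ⟩, Subtype.ext hγ, Subtype.ext hγy, Subtype.ext hyγ,
      Subtype.ext hw3, Subtype.ext hw4⟩
    constructor
    · refine hγJ.1.trans ?_
      rw [← hw3]; exact jle_mul_right _ _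
    · rw [← hw1]; exact (jle_mul_left _ _).trans hγJ.2
  · exact fun f g hf hg => Subtype.ext (band f g f.2 g.2 (congrArg Subtype.val hf)
      (congrArg Subtype.val hg))

end JOrder

/-! ### Consequences of membership in `DO`. -/

namespace classDO

variable {S : Type} [Semigroup S] [Finite S] [Nonempty S]

theorem exists_jClass_idem (hS : classDO S) {e : S} (he : e * e = e) :
    ∃ T : Subsemigroup S, (∀ x, x ∈ jClass e ↔ x ∈ T) ∧ IsRectangularGroup T := by
  obtain ⟨T, hT, h⟩ := hS e ⟨e, by rw [he, he]⟩
  exact ⟨T, fun x => by rw [← hT]; rfl, h⟩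

theorem mul_mem_jClass (hS : classDO S) {e a b : S} (he : e * e = e) (ha : a ∈ jClass e)
    (hb : b ∈ jClass e) : a * b ∈ jClass e := by
  obtain ⟨T, hT, -⟩ := hS.exists_jClass_idem he
  simp only [hT] at *
  exact T.mul_mem ha hb

theorem mul_idem_mul (hS : classDO S) {e a b : S} (he : e * e = e) (ha : a ∈ jClass e)
    (hb : b ∈ jClass e) : a * e * b = a * b := by
  obtain ⟨T, hT, hr⟩ := hS.exists_jClass_idem he
  have hee : e ∈ jClass e := ⟨JLE.refl e, JLE.refl e⟩
  simp only [hT] at *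
  exact congrArg Subtype.val (hr.mul_idem_mul (e := ⟨e, hee⟩) (Subtype.ext he) ⟨a, ha⟩ ⟨b, hb⟩)

theorem exists_inv_of_mem (hS : classDO S) {e a : S} (he : e * e = e) (ha : a ∈ jClass e) :
    ∃ y, e * y = y ∧ y * e = y ∧ e * a * e * y = e ∧ y * (e * a * e) = e := by
  obtain ⟨T, hT, hr⟩ := hS.exists_jClass_idem he
  have hee : e ∈ jClass e := ⟨JLE.refl e, JLE.refl e⟩
  simp only [hT] at *
  obtain ⟨y, h1, h2, h3, h4⟩ := hr.exists_inv (e := ⟨e, hee⟩) (Subtype.ext he) ⟨a, ha⟩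
  exact ⟨y, congrArg Subtype.val h1, congrArg Subtype.val h2, congrArg Subtype.val h3,
    congrArg Subtype.val h4⟩

/-- From `e = p x q`, the elements `x q p` and `q p x` lie in the `J`-class of `e`. This class is
closed under products, so `e x q p` and `q p x e` are in it, which forces `e x` and `x e` up to the
level of `e`. -/
theorem idem_mul_mem (hS : classDO S) {e x : S} (he : e * e = e) (h : JLE e x) :
    e * x ∈ jClass e ∧ x * e ∈ jClass e := by
  obtain ⟨p, q, hp, hq, hpq⟩ := h.exists_mul he
  have hee : e ∈ jClass e := ⟨JLE.refl e, JLE.refl e⟩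
  have h1 : x * q * p ∈ jClass e := by
    refine And.symm ⟨JLE.of_eq (p := x * q) (q := p) ?_, JLE.of_eq (p := p) (q := x * q) ?_⟩
    · rw [mul_assoc _ e, hp]
    · calc e = p * x * q * (p * x * q) := by rw [hpq, he]
        _ = _ := by simp only [mul_assoc]
  have h2 : q * p * x ∈ jClass e := by
    refine And.symm ⟨JLE.of_eq (p := q) (q := p * x) ?_, JLE.of_eq (p := p * x) (q := q) ?_⟩
    · rw [hq, mul_assoc]
    · calc e = p * x * q * (p * x * q) := by rw [hpq, he]
        _ = _ := by simp only [mul_assoc]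
  refine ⟨⟨(hS.mul_mem_jClass he hee h1).1.trans ?_, jle_mul_left _ _⟩,
    ⟨(hS.mul_mem_jClass he h2 hee).1.trans ?_, jle_mul_right _ _⟩⟩
  · rw [mul_assoc x, ← mul_assoc e]; exact jle_mul_left _ _
  · rw [mul_assoc (q * p)]; exact jle_mul_right _ _

theorem jle_mul (hS : classDO S) {e x y : S} (he : e * e = e) (hx : JLE e x) (hy : JLE e y) :
    JLE e (x * y) := by
  refine (hS.mul_mem_jClass he (hS.idem_mul_mem he hx).1 (hS.idem_mul_mem he hy).2).1.trans ?_
  exact JLE.of_eq (p := e) (q := e) (by simp only [mul_assoc])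

/-- Deleting the middle `e` from `(e f) e (f e)` shows that `e f e` is idempotent; it is also
invertible in the local group at `e`, so it equals `e`. -/
theorem absorbsIdempotents (hS : classDO S) : AbsorbsIdempotents S := by
  intro e f he hf hef
  have hee : e ∈ jClass e := ⟨JLE.refl e, JLE.refl e⟩
  obtain ⟨h1, h2⟩ := hS.idem_mul_mem he hef
  have hg : e * f * e * (f * e) = e * f * e := by
    rw [hS.mul_idem_mul he h1 h2, mul_assoc, ← mul_assoc f, hf, mul_assoc]
  have hgg : e * f * e * (e * f * e) = e * f * e := by
    calc e * f * e * (e * f * e) = e * f * (e * e) * (f * e) := by simp only [mul_assoc]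
      _ = _ := by rw [he, hg]
  obtain ⟨y, -, -, hy, -⟩ := hS.exists_inv_of_mem he (hS.mul_mem_jClass he h1 hee)
  have hc : e * (e * f * e) * e = e * f * e := by
    calc e * (e * f * e) * e = (e * e) * f * (e * e) := by simp only [mul_assoc]
      _ = _ := by rw [he]
  rw [hc] at hy
  calc e * f * e = e * f * e * e := by rw [mul_assoc _ e e, he]
    _ = e * f * e * (e * f * e) * y := by rw [mul_assoc _ _ y, hy]
    _ = e := by rw [hgg, hy]

end classDO

/-! ### Closure properties of `DO ∩ H̄` -/

instance WithOne.instFinite {S : Type} [Finite S] : Finite (WithOne S) :=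
  inferInstanceAs (Finite (Option S))

theorem IsGroupSemigroup.map_surjective {S T : Type} [Semigroup S] [Semigroup T]
    (hS : IsGroupSemigroup S) (h : S →ₙ* T) (hh : Function.Surjective h) : IsGroupSemigroup T := by
  obtain ⟨e, he, hinv⟩ := hS
  refine ⟨h e, fun x => ?_, fun x => ?_⟩ <;> obtain ⟨x, rfl⟩ := hh x
  · rw [← map_mul, ← map_mul, (he x).1, (he x).2]
    exact ⟨rfl, rfl⟩
  · obtain ⟨y, h1, h2⟩ := hinv x
    exact ⟨h y, by rw [← map_mul, h1], by rw [← map_mul, h2]⟩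

theorem IsGroupSemigroup.eq_of_idem {S : Type} [Semigroup S] (hS : IsGroupSemigroup S) {e x : S}
    (he : e * e = e) : e * x = x ∧ x * e = x := by
  obtain ⟨o, ho, hinv⟩ := hS
  obtain ⟨y, hy, -⟩ := hinv e
  have : e = o := by
    calc e = e * (e * y) := by rw [hy, (ho e).2]
      _ = o := by rw [← mul_assoc, he, hy]
  rw [this]
  exact ho x

theorem IsPseudovariety.of_subsingleton {H : SemigroupClass} (hH : IsPseudovariety H)
    {S : Type} [Semigroup S] [Finite S] [Nonempty S] [Subsingleton S] : H S := by
  obtain ⟨s⟩ := ‹Nonempty S›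
  exact hH.quot PUnit S ⟨fun _ => s, fun _ _ => Subsingleton.elim _ _⟩
    (fun x => ⟨PUnit.unit, Subsingleton.elim _ _⟩) hH.unit

theorem barClass.of_injective {H : SemigroupClass} (hH : IsPseudovariety H) {S K : Type}
    [Semigroup S] [Finite S] [Nonempty S] [Semigroup K] [Finite K] [Nonempty K]
    (hS : barClass H S) (hK : IsGroupSemigroup K) (h : K →ₙ* S) (hh : Function.Injective h) :
    H K := by
  have hsurj : Function.Surjective h.srangeRestrict := h.srangeRestrict_surjective
  have : Nonempty h.srange := (‹Nonempty K›).map h.srangeRestrict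
  refine hH.sub h.srange K h.srangeRestrict (fun x y hxy => hh (congrArg Subtype.val hxy))
    (hS _ (hK.map_surjective _ hsurj))

theorem classDOBar_of_mem {H : SemigroupClass} (hH : IsGroupPseudovariety H) {G : Type}
    [Semigroup G] [Finite G] [Nonempty G] (hG : H G) : classDOBar H G := by
  have hgrp := hH.isGroup G hG
  refine ⟨AbsorbsIdempotents.classDO fun e f he hf _ => ?_, fun T _ _ => ?_⟩
  · rw [(hgrp.eq_of_idem he).2, (hgrp.eq_of_idem hf).2]
  · exact hH.isPseudovariety.sub G T (MulMemClass.subtype T) Subtype.val_injective hG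

theorem JLE.exists_eq {M : Type} [Monoid M] {x y : M} (h : JLE x y) : ∃ a b : M, x = a * y * b := by
  obtain ⟨a, b, h⟩ := h
  have := congrArg (WithOne.lift (MulHom.id M)) h
  simp only [map_mul, WithOne.lift_coe] at this
  exact ⟨_, _, this⟩

/-- The value `1` is a product only of factors `1`. So a subgroup with identity `1` is trivial, and
any other subgroup avoids `1` and lies in `S`. -/
theorem classDOBar.withOne {H : SemigroupClass} (hH : IsGroupPseudovariety H) {S : Type}
    [Semigroup S] [Finite S] [Nonempty S] (hS : classDOBar H S) : classDOBar H (WithOne S) := by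
  constructor
  · refine AbsorbsIdempotents.classDO fun e f he hf hef => ?_
    obtain ⟨a, b, hab⟩ := hef.exists_eq
    induction e with
    | one =>
      induction f with
      | one => rfl
      | coe f => cases a <;> cases b <;> cases hab
    | coe e =>
      induction f with
      | one => simpa using he
      | coe f =>
        exact congrArg _ (hS.1.absorbsIdempotents e f (WithOne.coe_injective he)
          (WithOne.coe_injective hf) ⟨a, b, hab⟩)
  · intro K _ hK
    obtain ⟨⟨e, heK⟩, he, hinv⟩ := id hK
    induction e with
    | one =>
      have : Subsingleton K := by
        have h1 : ∀ x : K, x = ⟨1, heK⟩ := by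
          rintro ⟨x, hx⟩
          obtain ⟨⟨y, hyK⟩, hy, -⟩ := hinv ⟨x, hx⟩
          have hy : x * y = 1 := congrArg Subtype.val hy
          induction x with
          | one => rfl
          | coe x => cases y <;> cases hy
        exact ⟨fun x y => by rw [h1 x, h1 y]⟩
      exact hH.isPseudovariety.of_subsingleton
    | coe e =>
      have hne : ∀ x : K, (x : WithOne S) ≠ 1 := by
        rintro ⟨x, hx⟩ rfl
        obtain ⟨⟨y, hyK⟩, hy, -⟩ := hinv ⟨1, hx⟩
        have h1 : (1 : WithOne S) * y = e := congrArg Subtype.val hy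
        have h2 : (e : WithOne S) * 1 = 1 := congrArg Subtype.val (he ⟨1, hx⟩).1
        rw [mul_one] at h2
        exact WithOne.coe_ne_one h2
      refine barClass.of_injective hH.isPseudovariety hS.2 hK
        ⟨fun x => WithOne.unone (hne x), fun x y => ?_⟩ fun x y hxy => ?_
      · apply WithOne.coe_injective
        simp only [WithOne.coe_mul, WithOne.coe_unone]
        rfl
      · have := congrArg (WithOne.coe) hxy
        simpa only [MulHom.coe_mk, WithOne.coe_unone, SetLike.coe_eq_coe] using this

/-- A criterion for pulling membership back along `π`. The complement of `N` is an ideal. An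
idempotent in `N` only involves factors in `N`, where `π` is injective; one outside `N` identifies,
by multiplication on one side, all elements with the same image, so equations at this idempotent may
be checked in `M`. -/
theorem classDOBar.of_monoidHom {H : SemigroupClass} (hH : IsGroupPseudovariety H) {M T : Type}
    [Monoid M] [Finite M] [Monoid T] [Finite T] (hM : classDOBar H M) (π : T →* M) (N : Set T)
    (hN : ∀ x y, x * y ∈ N ↔ x ∈ N ∧ y ∈ N) (hinj : Set.InjOn π N)
    (hideal : ∀ e ∉ N, (∀ x y, π x = π y → e * x = e * y) ∨ (∀ x y, π x = π y → x * e = y * e)) :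
    classDOBar H T := by
  constructor
  · refine AbsorbsIdempotents.classDO fun e f he hf hef => ?_
    obtain ⟨a, b, hab⟩ := hef.exists_eq
    have hπ : π (e * f * e) = π e := by
      rw [map_mul, map_mul]
      refine hM.1.absorbsIdempotents _ _ (by rw [← map_mul, he]) (by rw [← map_mul, hf])
        (JLE.of_eq (p := π a) (q := π b) ?_)
      rw [hab, map_mul, map_mul]
    by_cases heN : e ∈ N
    · have hfN : f ∈ N := by
        rw [hab, hN, hN] at heN
        exact heN.1.2
      exact hinj (by rw [hN, hN]; exact ⟨⟨heN, hfN⟩, heN⟩) heN hπ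
    · rcases hideal e heN with h | h
      · have := h _ _ hπ
        rwa [← mul_assoc, ← mul_assoc, he] at this
      · have := h _ _ hπ
        rwa [mul_assoc, he] at this
  · intro K _ hK
    obtain ⟨⟨e, heK⟩, he, hinv⟩ := id hK
    refine barClass.of_injective hH.isPseudovariety hM.2 hK
      ((π : T →ₙ* M).comp (MulMemClass.subtype K)) fun x y hxy => Subtype.ext ?_
    have hxy : π x = π y := hxy
    have hex : ∀ x : K, e * x = x ∧ x * e = x := fun x =>
      ⟨congrArg Subtype.val (he x).1, congrArg Subtype.val (he x).2⟩
    by_cases heN : e ∈ N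
    · have hmem : ∀ x : K, (x : T) ∈ N := fun x => by
        obtain ⟨y, hy, -⟩ := hinv x
        have hy : (x : T) * y = e := congrArg Subtype.val hy
        rw [← hy, hN] at heN
        exact heN.1
      exact hinj (hmem x) (hmem y) hxy
    · rcases hideal e heN with h | h
      · rw [← (hex x).1, ← (hex y).1, h _ _ hxy]
      · rw [← (hex x).2, ← (hex y).2, h _ _ hxy]

/-! ### Cutting words at the first or at the last occurrence of a letter -/

/-- The values in a monoid of words, where a word in which a distinguished letter of value `c`
occurs is cut at one occurrence of that letter: the first one if `first` is true and the last one
if it is false. -/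
inductive CutWord {M : Type} (first : Bool) (c : M) : Type
  | word (m : M)
  | cut (l r : M)

namespace CutWord

variable {M : Type} {first : Bool} {c : M}

/-- The part that precedes the cut. -/
def left : CutWord first c → M
  | word m => m
  | cut l _ => l

/-- The part that follows the cut. -/
def right : CutWord first c → M
  | word m => m
  | cut _ r => r

instance [Finite M] : Finite (CutWord first c) := by
  refine Finite.of_injective (β := M ⊕ M × M)
    (fun x => match x with | word m => Sum.inl m | cut l r => Sum.inr (l, r)) ?_
  rintro (x | ⟨l, r⟩) (y | ⟨l', r'⟩) h <;> simp_all

variable [Monoid M]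

instance : Mul (CutWord first c) where
  mul
    | word x, word y => word (x * y)
    | word x, cut l r => cut (x * l) r
    | cut l r, word y => cut l (r * y)
    | cut l r, cut l' r' => bif first then cut l (r * (l' * c * r')) else cut (l * c * r * l') r'

theorem word_mul_word (x y : M) : (word x * word y : CutWord first c) = word (x * y) := rfl

theorem word_mul_cut (x l r : M) : (word x * cut l r : CutWord first c) = cut (x * l) r := rfl

theorem cut_mul_word (l r y : M) : (cut l r * word y : CutWord first c) = cut l (r * y) := rfl

theorem cut_mul_cut (l r l' r' : M) : (cut l r * cut l' r' : CutWord first c) =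
    bif first then cut l (r * (l' * c * r')) else cut (l * c * r * l') r' := rfl

instance : Monoid (CutWord first c) where
  one := word 1
  mul_assoc := by
    cases first <;> rintro (x | ⟨l, r⟩) (y | ⟨l', r'⟩) (z | ⟨l'', r''⟩) <;>
      simp [word_mul_word, word_mul_cut, cut_mul_word, cut_mul_cut, mul_assoc]
  one_mul := by
    rintro (x | ⟨l, r⟩)
    · exact congrArg word (one_mul x)
    · exact congrArg (fun x => cut x r) (one_mul l)
  mul_one := by
    rintro (x | ⟨l, r⟩)
    · exact congrArg word (mul_one x)
    · exact congrArg (cut l) (mul_one r)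

/-- The value of the uncut word. -/
def glue : CutWord first c →* M where
  toFun
    | word m => m
    | cut l r => l * c * r
  map_one' := rfl
  map_mul' := by
    cases first <;> rintro (x | ⟨l, r⟩) (y | ⟨l', r'⟩) <;>
      simp [cut_mul_cut, mul_assoc]

theorem glue_word (m : M) : glue (word m : CutWord first c) = m := rfl

theorem glue_cut (l r : M) : glue (cut l r : CutWord first c) = l * c * r := rfl

/-- Homomorphisms of monoids can be applied to the pieces of cut words. -/
def map {N : Type} [Monoid N] (h : M →* N) : CutWord first c →* CutWord first (h c) where
  toFun
    | word m => word (h m)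
    | cut l r => cut (h l) (h r)
  map_one' := congrArg word (map_one h)
  map_mul' := by
    cases first <;> rintro (x | ⟨l, r⟩) (y | ⟨l', r'⟩) <;>
      simp [word_mul_word, word_mul_cut, cut_mul_word, cut_mul_cut]

theorem left_map {N : Type} [Monoid N] (h : M →* N) (x : CutWord first c) :
    (map h x).left = h x.left := by
  cases x <;> rfl

theorem right_map {N : Type} [Monoid N] (h : M →* N) (x : CutWord first c) :
    (map h x).right = h x.right := by
  cases x <;> rfl

end CutWord

theorem classDOBar.cutWord {H : SemigroupClass} (hH : IsGroupPseudovariety H) {M : Type}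
    [Monoid M] [Finite M] (hM : classDOBar H M) (first : Bool) (c : M) :
    classDOBar H (CutWord first c) := by
  refine hM.of_monoidHom hH CutWord.glue (Set.range CutWord.word) ?_ ?_ ?_
  · rintro (x | ⟨l, r⟩) (y | ⟨l', r'⟩)
    · exact iff_of_true ⟨x * y, rfl⟩ ⟨⟨x, rfl⟩, ⟨y, rfl⟩⟩
    all_goals cases first <;> simp [CutWord.word_mul_cut, CutWord.cut_mul_word, CutWord.cut_mul_cut]
  · rintro _ ⟨x, rfl⟩ _ ⟨y, rfl⟩ h
    exact congrArg _ h
  · rintro (x | ⟨l, r⟩) he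
    · exact absurd ⟨x, rfl⟩ he
    -- Multiplying a cut word on the side away from the preserved outer piece only uses the glued
    -- value of the other factor.
    cases first
    · right
      rintro (x | ⟨l, r⟩) (y | ⟨l', r'⟩) h <;>
        simp_all [CutWord.word_mul_cut, CutWord.cut_mul_cut, CutWord.glue_word, CutWord.glue_cut]
    · left
      rintro (x | ⟨l, r⟩) (y | ⟨l', r'⟩) h <;>
        simp_all [CutWord.cut_mul_word, CutWord.cut_mul_cut, CutWord.glue_word, CutWord.glue_cut]

/-! ### Evaluation of pseudowords -/

namespace FreeProfinite

variable {A : Type}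

section Eval

variable {S : Type} [Semigroup S] [Finite S] [Nonempty S]

/-- Evaluation of pseudowords in a finite semigroup. -/
def evalHom (f : A → S) : FreeProfinite A →ₙ* S where
  toFun u := u.eval S trivial f
  map_mul' _ _ := rfl

/-- Evaluation of possibly empty pseudowords in a finite semigroup. -/
def evalOne (f : A → S) : WithOne (FreeProfinite A) →* WithOne S := WithOne.mapMulHom (evalHom f)

theorem evalOne_coe (f : A → S) (u : FreeProfinite A) : evalOne f u = evalHom f u := rfl

theorem map_evalHom {T : Type} [Semigroup T] [Finite T] [Nonempty T] (g : S →ₙ* T) (f : A → S)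
    (u : FreeProfinite A) : g (evalHom f u) = evalHom (fun a => g (f a)) u :=
  u.natural S T trivial trivial g f

/-- Such a pseudoword would be a constant compatible with all homomorphisms, hence equal to both
idempotents of the two-element semilattice. -/
theorem false_of_isEmpty [IsEmpty A] (u : FreeProfinite A) : False := by
  have h : ∀ x : WithOne PUnit, x * x = x → evalHom isEmptyElim u = x := fun x hx =>
    calc evalHom isEmptyElim u = evalHom (fun _ => x) u :=
          congrArg (fun f => evalHom f u) (Subsingleton.elim _ _)
      _ = x := (map_evalHom (⟨fun _ => x, fun _ _ => hx.symm⟩ : PUnit →ₙ* WithOne PUnit)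
          (fun _ => PUnit.unit) u).symm
  exact WithOne.coe_ne_one ((h (PUnit.unit : PUnit) rfl).symm.trans (h 1 rfl))

/-- This is the induction principle for pseudowords: a property of values that holds for letters and
is closed under products holds throughout. It is naturality for the inclusion of `T`. -/
theorem evalHom_mem {f : A → S} {T : Subsemigroup S} (hf : ∀ a, f a ∈ T) (u : FreeProfinite A) :
    evalHom f u ∈ T := by
  cases isEmpty_or_nonempty A with
  | inl _ => exact (false_of_isEmpty u).elim
  | inr h =>
    obtain ⟨a⟩ := h
    have : Nonempty T := ⟨⟨f a, hf a⟩⟩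
    have := map_evalHom (MulMemClass.subtype T) (fun a => (⟨f a, hf a⟩ : T)) u
    change _ = evalHom f u at this
    rw [← this]
    exact Subtype.property _

end Eval

theorem evalOne_ext {x y : WithOne (FreeProfinite A)}
    (h : ∀ (S : Type) [Semigroup S] [Finite S] [Nonempty S] (f : A → S),
      evalOne f x = evalOne f y) : x = y := by
  induction x with
  | one =>
    induction y with
    | one => rfl
    | coe v => exact absurd (h PUnit fun _ => PUnit.unit).symm WithOne.coe_ne_one
  | coe u =>
    induction y with
    | one => exact absurd (h PUnit fun _ => PUnit.unit) WithOne.coe_ne_one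
    | coe v =>
      congr 1
      apply ImplicitOp.ext
      funext S _ _ _ _ f
      exact WithOne.coe_injective (h S f)

/-- A natural family of values is an implicit operation; the trivial semigroup decides whether it is
the empty one. -/
theorem exists_evalOne_eq
    (E : ∀ (S : Type) [Semigroup S] [Finite S] [Nonempty S], (A → S) → WithOne S)
    (hE : ∀ (S T : Type) [Semigroup S] [Finite S] [Nonempty S] [Semigroup T] [Finite T]
      [Nonempty T] (g : S →ₙ* T) (f : A → S),
      WithOne.mapMulHom g (E S f) = E T (fun a => g (f a))) :
    ∃ x : WithOne (FreeProfinite A), ∀ (S : Type) [Semigroup S] [Finite S] [Nonempty S]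
      (f : A → S), evalOne f x = E S f := by
  have hPUnit : ∀ (S : Type) [Semigroup S] [Finite S] [Nonempty S] (f : A → S),
      E S f = 1 ↔ E PUnit (fun _ => PUnit.unit) = 1 := by
    intro S _ _ _ f
    rw [← hE S PUnit ⟨fun _ => PUnit.unit, fun _ _ => rfl⟩ f]
    cases E S f <;> simp
  by_cases h : E PUnit (fun _ => PUnit.unit) = 1
  · exact ⟨1, fun S _ _ _ f => ((hPUnit S f).2 h).symm⟩
  · have hne : ∀ (S : Type) [Semigroup S] [Finite S] [Nonempty S] (f : A → S), E S f ≠ 1 :=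
      fun S _ _ _ f h' => h ((hPUnit S f).1 h')
    refine ⟨((⟨fun S _ _ _ _ f => WithOne.unone (hne S f), ?_⟩ : FreeProfinite A) :
      WithOne (FreeProfinite A)), fun S _ _ _ f => WithOne.coe_unone (hne S f)⟩
    intro S T _ _ _ _ _ _ _ _ g f
    apply WithOne.coe_injective
    rw [WithOne.coe_unone, ← WithOne.mapMulHom_coe, WithOne.coe_unone, hE]

theorem lift_evalHom_eq_lift_evalOne {M : Type} [Monoid M] [Finite M] (f : A → M)
    (x : WithOne (FreeProfinite A)) :
    WithOne.lift (evalHom f) x = WithOne.lift (MulHom.id M) (evalOne f x) := by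
  cases x <;> rfl

/-! ### Equality over a class of finite semigroups -/

/-- The possibly empty pseudowords `x` and `y` take the same values in all members of `V`. -/
def AgreeOn (V : SemigroupClass) (x y : WithOne (FreeProfinite A)) : Prop :=
  ∀ (S : Type) [Semigroup S] [Finite S] [Nonempty S], V S → ∀ f : A → S, evalOne f x = evalOne f y

namespace AgreeOn

variable {V : SemigroupClass} {x y : WithOne (FreeProfinite A)}

theorem mul {x' y' : WithOne (FreeProfinite A)} (h : AgreeOn V x y) (h' : AgreeOn V x' y') :
    AgreeOn V (x * x') (y * y') := by
  intro S _ _ _ hS f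
  rw [map_mul, map_mul, h S hS, h' S hS]

theorem lift_evalHom (h : AgreeOn V x y) {M : Type} [Monoid M] [Finite M] (hM : V M) (f : A → M) :
    WithOne.lift (evalHom f) x = WithOne.lift (evalHom f) y := by
  rw [lift_evalHom_eq_lift_evalOne, lift_evalHom_eq_lift_evalOne, h M hM]

theorem evalHom_eq {u v : FreeProfinite A} (h : AgreeOn V (u : WithOne (FreeProfinite A)) v)
    {S : Type} [Semigroup S] [Finite S] [Nonempty S] (hS : V S) (f : A → S) :
    evalHom f u = evalHom f v :=
  WithOne.coe_injective (h S hS f)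

theorem proj_eq {u v : FreeProfinite A} (h : AgreeOn V (u : WithOne (FreeProfinite A)) v) :
    proj V u = proj V v := by
  apply ImplicitOp.ext
  funext S _ _ _ hS f
  exact h.evalHom_eq hS f

theorem of_proj_eq {u v : FreeProfinite A} (h : proj V u = proj V v) :
    AgreeOn V (u : WithOne (FreeProfinite A)) v := fun S _ _ _ hS f =>
  congrArg (fun p : ImplicitOp V A => ((p.eval S hS f : S) : WithOne S)) h

end AgreeOn

/-! ### The content of a pseudoword -/

theorem _root_.WithOne.mul_eq_one_iff {S : Type*} [Mul S] {x y : WithOne S} :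
    x * y = 1 ↔ x = 1 ∧ y = 1 := by
  cases x <;> cases y <;> simp [← WithOne.coe_mul]

/-- The value of the letter `b` that records whether the letter is equal to `a`. -/
noncomputable def letterMark (a b : A) : WithOne PUnit.{1} := by
  classical exact if b = a then (PUnit.unit : PUnit.{1}) else 1

theorem letterMark_self (a : A) : letterMark a a ≠ 1 := by simp [letterMark]

theorem letterMark_of_ne {a b : A} (h : b ≠ a) : letterMark a b = 1 := by simp [letterMark, h]

/-- The set of letters that occur in a possibly empty pseudoword. -/
def content (x : WithOne (FreeProfinite A)) : Set A :=
  {a | WithOne.lift (evalHom (letterMark a)) x ≠ 1}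

theorem content_one : content (1 : WithOne (FreeProfinite A)) = ∅ := by
  ext a; simp [content]

theorem content_mul (x y : WithOne (FreeProfinite A)) :
    content (x * y) = content x ∪ content y := by
  ext a
  simp only [content, map_mul, Set.mem_ofPred_eq, Set.mem_union, ne_eq, WithOne.mul_eq_one_iff]
  tauto

theorem content_of (a : A) : content (of a : WithOne (FreeProfinite A)) = {a} := by
  ext b
  rw [Set.mem_singleton_iff]
  change letterMark b a ≠ 1 ↔ b = a
  refine ⟨fun h => by_contra fun hne => h (letterMark_of_ne (Ne.symm hne)), ?_⟩
  rintro rfl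
  exact letterMark_self _

theorem AgreeOn.content_eq {V : SemigroupClass} {x y : WithOne (FreeProfinite A)}
    (h : AgreeOn V x y) (hV : V (WithOne PUnit)) : content x = content y := by
  ext a
  rw [content, content, Set.mem_ofPred_eq, Set.mem_ofPred_eq, h.lift_evalHom hV]

/-- The content of a nonempty pseudoword as an element of a finite semigroup. -/
noncomputable def contentHom [Finite A] : FreeProfinite A →ₙ* (A → WithOne PUnit.{1}) :=
  evalHom fun b a => letterMark a b

theorem contentHom_apply [Finite A] (u : FreeProfinite A) (a : A) :
    contentHom u a = evalHom (letterMark a) u :=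
  map_evalHom (Pi.evalMulHom (fun _ : A => WithOne PUnit.{1}) a) _ u

theorem mem_content_coe [Finite A] {u : FreeProfinite A} {a : A} :
    a ∈ content (u : WithOne (FreeProfinite A)) ↔ contentHom u a ≠ 1 := by
  rw [contentHom_apply]; rfl

theorem content_coe_nonempty [Finite A] (u : FreeProfinite A) :
    (content (u : WithOne (FreeProfinite A))).Nonempty := by
  let T : Subsemigroup (A → WithOne PUnit.{1}) :=
    { carrier := {x | ∃ a, x a ≠ 1}
      mul_mem' := by
        rintro x y ⟨a, ha⟩ -
        exact ⟨a, fun h => ha (WithOne.mul_eq_one_iff.1 h).1⟩ }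
  obtain ⟨a, ha⟩ : contentHom u ∈ T := evalHom_mem (T := T)
    (f := fun b a => letterMark a b) (fun a => ⟨a, letterMark_self a⟩) u
  exact ⟨a, mem_content_coe.2 ha⟩

theorem evalHom_congr [Finite A] {S : Type} [Semigroup S] [Finite S] [Nonempty S] {f g : A → S}
    {u : FreeProfinite A} (h : ∀ a ∈ content (u : WithOne (FreeProfinite A)), f a = g a) :
    evalHom f u = evalHom g u := by
  -- The third coordinate records the content, which makes the implication closed under products.
  let T : Subsemigroup (S × S × (A → WithOne PUnit.{1})) :=
    { carrier := {x | (∀ a, x.2.2 a ≠ 1 → f a = g a) → x.1 = x.2.1}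
      mul_mem' := by
        intro x y hx hy hxy
        have h1 := hx fun a ha => hxy a fun h => ha (WithOne.mul_eq_one_iff.1 h).1
        have h2 := hy fun a ha => hxy a fun h => ha (WithOne.mul_eq_one_iff.1 h).2
        change x.1 * y.1 = x.2.1 * y.2.1
        rw [h1, h2] }
  let F : A → S × S × (A → WithOne PUnit.{1}) := fun b => (f b, g b, fun a => letterMark a b)
  have hT : evalHom F u ∈ T := evalHom_mem (fun a ha => ha a (letterMark_self a)) u
  have h1 := map_evalHom (MulHom.fst S (S × (A → WithOne PUnit.{1}))) F u
  have h2 := map_evalHom ((MulHom.fst S (A → WithOne PUnit.{1})).comp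
    (MulHom.snd S (S × (A → WithOne PUnit.{1})))) F u
  have h3 := map_evalHom ((MulHom.snd S (A → WithOne PUnit.{1})).comp
    (MulHom.snd S (S × (A → WithOne PUnit.{1})))) F u
  refine h1.symm.trans (Eq.trans (hT fun a ha => h a (mem_content_coe.2 ?_)) h2)
  exact fun h' => ha ((congrFun h3 a).trans h')

/-! ### Cutting pseudowords -/

section Cut

variable {S : Type} [Semigroup S] [Finite S]

/-- The value of a possibly empty pseudoword that is cut at an occurrence of the letter `a`. -/
noncomputable def cutEval (first : Bool) (a : A) (f : A → S) :
    WithOne (FreeProfinite A) →* CutWord first (f a : WithOne S) := by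
  classical
  exact WithOne.lift (evalHom fun b => if b = a then CutWord.cut 1 1 else CutWord.word (f b))

theorem map_cutEval {T : Type} [Semigroup T] [Finite T] (first : Bool) (a : A)
    (g : S →ₙ* T) (f : A → S) (x : WithOne (FreeProfinite A)) :
    CutWord.map (WithOne.mapMulHom g) (cutEval first a f x) =
      cutEval first a (fun b => g (f b)) x := by
  classical
  induction x with
  | one => rfl
  | coe u =>
    refine (map_evalHom (CutWord.map (first := first) (c := (f a : WithOne S))
      (WithOne.mapMulHom g)).toMulHom _ u).trans ?_
    change _ = evalHom _ u
    refine congrArg (fun f => evalHom f u) (funext fun b => ?_)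
    by_cases hb : b = a
    · simp only [hb, if_true]; rfl
    · simp only [hb, if_false]; rfl

theorem glue_cutEval [Nonempty S] (first : Bool) (a : A) (f : A → S) (x : WithOne (FreeProfinite A)) :
    (cutEval first a f x).glue = evalOne f x := by
  classical
  induction x with
  | one => rfl
  | coe u =>
    refine (map_evalHom (CutWord.glue (first := first) (c := (f a : WithOne S))).toMulHom _ u).trans ?_
    refine Eq.trans ?_ (map_evalHom WithOne.coeMulHom f u).symm
    refine congrArg (fun f => evalHom f u) (funext fun b => ?_)
    by_cases hb : b = a
    · simp [hb, CutWord.glue_cut]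
    · simp [hb, CutWord.glue_word]

theorem exists_cutEval_eq_cut {first : Bool} {a : A} {x : WithOne (FreeProfinite A)}
    (ha : a ∈ content x) (f : A → S) : ∃ l r, cutEval first a f x = CutWord.cut l r := by
  classical
  -- `κ` remembers only whether a cut has been made, which is the mark of the letter `a`.
  let κ : CutWord first (f a : WithOne S) →* WithOne PUnit.{1} :=
    { toFun := fun x => match x with
        | CutWord.word _ => 1
        | CutWord.cut _ _ => (PUnit.unit : PUnit.{1})
      map_one' := rfl
      map_mul' := by
        cases first <;> rintro (x | ⟨l, r⟩) (y | ⟨l', r'⟩) <;> rfl }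
  have hκ : κ (cutEval first a f x) = WithOne.lift (evalHom (letterMark a)) x := by
    induction x with
    | one => rfl
    | coe u =>
      refine (map_evalHom κ.toMulHom _ u).trans ?_
      change _ = evalHom _ u
      refine congrArg (fun f => evalHom f u) (funext fun b => ?_)
      by_cases hb : b = a
      · simp only [hb, if_true, letterMark]; rfl
      · simp only [hb, if_false, letterMark]; rfl
  cases h : cutEval first a f x with
  | word m => rw [h] at hκ; exact absurd hκ.symm ha
  | cut l r => exact ⟨l, r, rfl⟩

end Cut

theorem exists_leftPart (first : Bool) (a : A) (x : WithOne (FreeProfinite A)) :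
    ∃ y : WithOne (FreeProfinite A), ∀ (S : Type) [Semigroup S] [Finite S] [Nonempty S]
      (f : A → S), evalOne f y = (cutEval first a f x).left :=
  exists_evalOne_eq _ fun S T _ _ _ _ _ _ g f => by
    rw [← map_cutEval]; exact (CutWord.left_map _ _).symm

theorem exists_rightPart (first : Bool) (a : A) (x : WithOne (FreeProfinite A)) :
    ∃ y : WithOne (FreeProfinite A), ∀ (S : Type) [Semigroup S] [Finite S] [Nonempty S]
      (f : A → S), evalOne f y = (cutEval first a f x).right :=
  exists_evalOne_eq _ fun S T _ _ _ _ _ _ g f => by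
    rw [← map_cutEval]; exact (CutWord.right_map _ _).symm

/-- The part of a pseudoword that precedes its first or its last occurrence of a letter. -/
noncomputable def leftPart (first : Bool) (a : A) (x : WithOne (FreeProfinite A)) :
    WithOne (FreeProfinite A) :=
  (exists_leftPart first a x).choose

/-- The part of a pseudoword that follows its first or its last occurrence of a letter. -/
noncomputable def rightPart (first : Bool) (a : A) (x : WithOne (FreeProfinite A)) :
    WithOne (FreeProfinite A) :=
  (exists_rightPart first a x).choose

theorem evalOne_leftPart (first : Bool) (a : A) (x : WithOne (FreeProfinite A)) {S : Type}
    [Semigroup S] [Finite S] [Nonempty S] (f : A → S) :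
    evalOne f (leftPart first a x) = (cutEval first a f x).left :=
  (exists_leftPart first a x).choose_spec S f

theorem evalOne_rightPart (first : Bool) (a : A) (x : WithOne (FreeProfinite A)) {S : Type}
    [Semigroup S] [Finite S] [Nonempty S] (f : A → S) :
    evalOne f (rightPart first a x) = (cutEval first a f x).right :=
  (exists_rightPart first a x).choose_spec S f

theorem leftPart_mul_rightPart (first : Bool) {a : A} {x : WithOne (FreeProfinite A)}
    (ha : a ∈ content x) : leftPart first a x * of a * rightPart first a x = x := by
  refine evalOne_ext fun S _ _ _ f => ?_
  obtain ⟨l, r, h⟩ := exists_cutEval_eq_cut (first := first) ha f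
  rw [map_mul, map_mul, evalOne_leftPart, evalOne_rightPart, ← glue_cutEval first a f x, h]
  rfl

theorem notMem_content_leftPart (a : A) (x : WithOne (FreeProfinite A)) :
    a ∉ content (leftPart true a x) := by
  classical
  rw [content, Set.mem_ofPred_eq, not_not, lift_evalHom_eq_lift_evalOne, evalOne_leftPart]
  -- The left part stays free of `a` under products, because the cut at the first occurrence is
  -- kept.
  let T : Subsemigroup (CutWord true (WithOne.coe (letterMark a a))) :=
    { carrier := {x | WithOne.lift (MulHom.id (WithOne PUnit.{1})) x.left = 1}
      mul_mem' := by
        rintro (x | ⟨l, r⟩) (y | ⟨l', r'⟩) hx hy <;>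
          simp_all [CutWord.word_mul_word, CutWord.word_mul_cut, CutWord.cut_mul_word,
            CutWord.cut_mul_cut, CutWord.left] }
  cases x with
  | one => rfl
  | coe u =>
    refine evalHom_mem (T := T) (f := fun b => if b = a then CutWord.cut 1 1
      else CutWord.word (WithOne.coe (letterMark a b))) (fun b => ?_) u
    by_cases hb : b = a
    · rw [if_pos hb]; rfl
    · rw [if_neg hb]; exact letterMark_of_ne hb

theorem notMem_content_rightPart (a : A) (x : WithOne (FreeProfinite A)) :
    a ∉ content (rightPart false a x) := by
  classical
  rw [content, Set.mem_ofPred_eq, not_not, lift_evalHom_eq_lift_evalOne, evalOne_rightPart]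
  let T : Subsemigroup (CutWord false (WithOne.coe (letterMark a a))) :=
    { carrier := {x | WithOne.lift (MulHom.id (WithOne PUnit.{1})) x.right = 1}
      mul_mem' := by
        rintro (x | ⟨l, r⟩) (y | ⟨l', r'⟩) hx hy <;>
          simp_all [CutWord.word_mul_word, CutWord.word_mul_cut, CutWord.cut_mul_word,
            CutWord.cut_mul_cut, CutWord.right] }
  cases x with
  | one => rfl
  | coe u =>
    refine evalHom_mem (T := T) (f := fun b => if b = a then CutWord.cut 1 1
      else CutWord.word (WithOne.coe (letterMark a b))) (fun b => ?_) u
    by_cases hb : b = a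
    · rw [if_pos hb]; rfl
    · rw [if_neg hb]; exact letterMark_of_ne hb

section AgreeOnParts

variable {H : SemigroupClass} {x y : WithOne (FreeProfinite A)}

/-- Cutting is itself an evaluation, in the cut words over `S¹`, which again belong to `DO ∩ H̄`. -/
theorem AgreeOn.cutEval_eq (hH : IsGroupPseudovariety H) (h : AgreeOn (classDOBar H) x y)
    (first : Bool) (a : A) {S : Type} [Semigroup S] [Finite S] [Nonempty S]
    (hS : classDOBar H S) (f : A → S) : cutEval first a f x = cutEval first a f y :=
  h.lift_evalHom ((hS.withOne hH).cutWord hH first _) _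

theorem AgreeOn.leftPart (hH : IsGroupPseudovariety H) (h : AgreeOn (classDOBar H) x y)
    (first : Bool) (a : A) : AgreeOn (classDOBar H) (leftPart first a x) (leftPart first a y) := by
  intro S _ _ _ hS f
  rw [evalOne_leftPart, evalOne_leftPart, h.cutEval_eq hH first a hS]

theorem AgreeOn.rightPart (hH : IsGroupPseudovariety H) (h : AgreeOn (classDOBar H) x y)
    (first : Bool) (a : A) :
    AgreeOn (classDOBar H) (rightPart first a x) (rightPart first a y) := by
  intro S _ _ _ hS f
  rw [evalOne_rightPart, evalOne_rightPart, h.cutEval_eq hH first a hS]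

end AgreeOnParts

/-! ### Continuous homomorphisms into finite semigroups -/

theorem continuous_evalHom {S : Type} [Semigroup S] [Finite S] [Nonempty S] (f : A → S) :
    Continuous[_, ⊥] (evalHom f) := by
  rw [continuous_iff_le_induced]
  exact (iInf_le _ S).trans <| (iInf_le _ _).trans <| (iInf_le _ _).trans <| (iInf_le _ _).trans <|
    (iInf_le _ trivial).trans (iInf_le _ f)

/-- One finite semigroup suffices for a basic neighbourhood, since finitely many conditions combine
in a direct product. -/
theorem exists_evalHom_of_isOpen {U : Set (FreeProfinite A)} (hU : IsOpen U)
    {u : FreeProfinite A} (hu : u ∈ U) :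
    ∃ (S : Type) (_ : Semigroup S) (_ : Finite S) (_ : Nonempty S) (f : A → S),
      ∀ v, evalHom f v = evalHom f u → v ∈ U := by
  let τ : TopologicalSpace (FreeProfinite A) :=
    { IsOpen := fun U => ∀ u ∈ U, ∃ (S : Type) (_ : Semigroup S) (_ : Finite S) (_ : Nonempty S)
        (f : A → S), ∀ v, evalHom f v = evalHom f u → v ∈ U
      isOpen_univ := fun u _ => ⟨PUnit, inferInstance, inferInstance, inferInstance,
        fun _ => PUnit.unit, fun _ _ => trivial⟩
      isOpen_inter := by
        rintro U V hU hV u ⟨huU, huV⟩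
        obtain ⟨S, _, _, _, f, hf⟩ := hU u huU
        obtain ⟨T, _, _, _, g, hg⟩ := hV u huV
        refine ⟨S × T, inferInstance, inferInstance, inferInstance, fun a => (f a, g a),
          fun v hv => ⟨hf v ?_, hg v ?_⟩⟩
        · have := congrArg (MulHom.fst S T) hv
          rwa [map_evalHom, map_evalHom] at this
        · have := congrArg (MulHom.snd S T) hv
          rwa [map_evalHom, map_evalHom] at this
      isOpen_sUnion := by
        rintro s hs u ⟨U, hUs, hu⟩
        obtain ⟨S, i, j, k, f, hf⟩ := hs U hUs u hu
        exact ⟨S, i, j, k, f, fun v hv => ⟨U, hUs, hf v hv⟩⟩ }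
  have hτ : τ ≤ ImplicitOp.instTopologicalSpace allFiniteSemigroups A := by
    unfold ImplicitOp.instTopologicalSpace
    simp only [le_iInf_iff]
    intro S _ _ _ _ f
    rintro _ ⟨W, -, rfl⟩ u hu
    refine ⟨S, inferInstance, inferInstance, inferInstance, f, fun v hv => ?_⟩
    change evalHom f v ∈ W
    rw [hv]
    exact hu
  exact hτ U hU u hu

/-- By continuity `φ u` is determined by the value of `u` in some finite `T`. Some `v` satisfies the
formula and has the values of `u` in both `T` and `S`, so the formula passes to `u`. -/
theorem apply_eq_evalHom {S : Type} [Semigroup S] [Finite S] [Nonempty S]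
    {φ : FreeProfinite A →ₙ* S} (hφ : Continuous[_, ⊥] φ) (u : FreeProfinite A) :
    φ u = evalHom (fun a => φ (of a)) u := by
  have hU : IsOpen (φ ⁻¹' {φ u}) := by
    exact @Continuous.isOpen_preimage _ _ _ ⊥ _ hφ _ trivial
  obtain ⟨T, _, _, _, f, hf⟩ := exists_evalHom_of_isOpen hU (u := u) rfl
  let F : A → T × S := fun a => (f a, φ (of a))
  let K : Subsemigroup (T × S) :=
    { carrier := {t | ∃ v, evalHom F v = t ∧ φ v = evalHom (fun a => φ (of a)) v}
      mul_mem' := by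
        rintro _ _ ⟨v, rfl, hv⟩ ⟨w, rfl, hw⟩
        exact ⟨v * w, map_mul _ _ _, by rw [map_mul, map_mul, hv, hw]⟩ }
  obtain ⟨v, hv, hφv⟩ : evalHom F u ∈ K := evalHom_mem (T := K) (f := F) (fun a => ⟨of a, rfl, rfl⟩) u
  have h1 := congrArg (MulHom.fst T S) hv
  have h2 := congrArg (MulHom.snd T S) hv
  rw [map_evalHom, map_evalHom] at h1 h2
  have h3 : φ v = φ u := hf v h1
  rw [← h3, hφv]
  exact h2

/-- Pointlikeness can be tested on one alphabet: substituting preimages `θ a` of the letter values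
carries the witness to any other `ψ`. -/
theorem isPointlike_of_witness {V : SemigroupClass} {S : Type} [Semigroup S] [Finite S]
    [Nonempty S] {f : A → S} {P : Set S} {P' : Set (FreeProfinite A)}
    (h : IsPointlikeWitness V (evalHom f) P P') : IsPointlike V P := by
  intro B _ ψ hψ hsurj
  choose θ hθ using fun a => hsurj (f a)
  obtain ⟨rfl, q, hq⟩ := h
  have hψθ : ∀ u : FreeProfinite A, ψ (u.subst θ) = evalHom f u := by
    intro u
    rw [apply_eq_evalHom hψ]
    change u.eval S trivial (fun a => evalHom (fun b => ψ (of b)) (θ a)) = u.eval S trivial f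
    congr 1
    funext a
    rw [← apply_eq_evalHom hψ, hθ]
  refine ⟨(fun u => u.subst θ) '' P', ?_, ?_⟩
  · rw [Set.image_image]
    exact Set.image_congr fun u _ => hψθ u
  · obtain ⟨u, hu, -⟩ : q ∈ proj V '' P' := hq ▸ rfl
    refine ⟨proj V (u.subst θ), Set.eq_singleton_iff_unique_mem.2 ⟨⟨_, ⟨u, hu, rfl⟩, rfl⟩, ?_⟩⟩
    rintro _ ⟨_, ⟨v, hv, rfl⟩, rfl⟩
    have huv : proj V v = proj V u := by
      have h1 : proj V v ∈ proj V '' P' := ⟨v, hv, rfl⟩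
      have h2 : proj V u ∈ proj V '' P' := ⟨u, hu, rfl⟩
      rw [hq, Set.mem_singleton_iff] at h1 h2
      rw [h1, h2]
    apply ImplicitOp.ext
    funext T _ _ _ hT g
    exact congrArg (fun p : ImplicitOp V A => p.eval T hT fun a => (θ a).eval T trivial g) huv

end FreeProfinite

/-! ### Iterated factorizations and idempotent powers -/

theorem exists_factor_of_finset {F A : Type*} [Monoid F] (G : Submonoid F) (c : F → Set A)
    (hc : ∀ x y, c (x * y) = c x ∪ c y) (B : Finset A)
    (h : ∀ u, ∀ b ∈ B, u ∈ G ∨ ∃ x r, u = x * r ∧ x ∈ G ∧ b ∈ c x) (u : F) :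
    u ∈ G ∨ ∃ x r, u = x * r ∧ x ∈ G ∧ (B : Set A) ⊆ c x := by
  classical
  induction B using Finset.induction_on generalizing u with
  | empty => exact Or.inr ⟨1, u, (one_mul u).symm, G.one_mem, by simp⟩
  | insert b B _ ih =>
    rcases h u b (Finset.mem_insert_self b B) with hu | ⟨x, r, rfl, hx, hb⟩
    · exact Or.inl hu
    · rcases ih (fun u b' hb' => h u b' (Finset.mem_insert_of_mem hb')) r with
        hr | ⟨y, s, rfl, hy, hB⟩
      · exact Or.inl (G.mul_mem hx hr)
      · refine Or.inr ⟨x * y, s, (mul_assoc _ _ _).symm, G.mul_mem hx hy, ?_⟩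
        rw [hc, Finset.coe_insert, Set.insert_subset_iff]
        exact ⟨Or.inl hb, hB.trans Set.subset_union_right⟩

theorem exists_factor_pow {F N A : Type*} [Monoid F] [Monoid N] [Finite N] (Φ : F →* N)
    (G : Submonoid F) (c : F → Set A) (hc : ∀ x y, c (x * y) = c x ∪ c y) (B : Finset A)
    (h : ∀ u, ∀ b ∈ B, u ∈ G ∨ ∃ x r, u = x * r ∧ x ∈ G ∧ b ∈ c x) (u : F) :
    u ∈ G ∨ ∃ p e r, p ∈ G ∧ e ∈ G ∧ (B : Set A) ⊆ c e ∧
      ∀ k : ℕ, Φ u = Φ p * Φ e ^ k * Φ r := by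
  by_cases hu : u ∈ G
  · exact Or.inl hu
  right
  -- As long as the remainder `r` is outside `G`, a prefix in `G` covering `B` splits off and leaves
  -- a remainder outside `G`. For `r ∈ G` the values are irrelevant.
  have step : ∀ r, ∃ x r', r ∉ G → r' ∉ G ∧ r = x * r' ∧ x ∈ G ∧ (B : Set A) ⊆ c x := by
    intro r
    by_cases hr : r ∈ G
    · exact ⟨1, 1, fun h => absurd hr h⟩
    · obtain ⟨x, r', hxr, hx, hB⟩ := (exists_factor_of_finset G c hc B h r).resolve_left hr
      exact ⟨x, r', fun _ => ⟨fun hr' => hr (hxr ▸ G.mul_mem hx hr'), hxr, hx, hB⟩⟩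
  choose X R hXR using step
  have hR : ∀ n, R^[n] u ∉ G := by
    intro n
    induction n with
    | zero => exact hu
    | succ n ih => rw [Function.iterate_succ_apply']; exact (hXR _ ih).1
  let p : ℕ → F := fun n => Nat.rec 1 (fun n q => q * X (R^[n] u)) n
  have hp : ∀ n, p (n + 1) = p n * X (R^[n] u) := fun _ => rfl
  have hpG : ∀ n, p n ∈ G := by
    intro n
    induction n with
    | zero => exact G.one_mem
    | succ n ih => exact G.mul_mem ih (hXR _ (hR n)).2.2.1
  have hpR : ∀ n, u = p n * R^[n] u := by
    intro n
    induction n with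
    | zero => exact (one_mul u).symm
    | succ n ih =>
      rw [hp, Function.iterate_succ_apply', mul_assoc, ← (hXR _ (hR n)).2.1, ← ih]
  have hblock : ∀ m k, ∃ e ∈ G, (B : Set A) ⊆ c e ∧ p (m + k + 1) = p m * e := by
    intro m k
    induction k with
    | zero => exact ⟨_, (hXR _ (hR m)).2.2.1, (hXR _ (hR m)).2.2.2, rfl⟩
    | succ k ih =>
      obtain ⟨e, he, hB, hpe⟩ := ih
      refine ⟨e * X (R^[m + k + 1] u), G.mul_mem he (hXR _ (hR _)).2.2.1, ?_, ?_⟩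
      · rw [hc]; exact hB.trans Set.subset_union_left
      · exact (hp (m + k + 1)).trans (by rw [hpe, mul_assoc])
  -- Two prefixes have the same value in `N`; the block `e` between them satisfies `Φ (p i) = Φ (p
  -- i) * Φ e`, so its powers can be inserted freely.
  obtain ⟨i, j, hne, hij⟩ := Finite.exists_ne_map_eq_of_infinite fun n => Φ (p n)
  wlog hlt : i < j generalizing i j
  · exact this j i hne.symm hij.symm (by omega)
  obtain ⟨d, rfl⟩ := Nat.exists_eq_add_of_lt hlt
  obtain ⟨e, he, hB, hpe⟩ := hblock i d
  refine ⟨p i, e, R^[i] u, hpG i, he, hB, fun k => ?_⟩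
  have hk : Φ (p i) = Φ (p i) * Φ e ^ k := by
    induction k with
    | zero => simp
    | succ k ih =>
      rw [pow_succ, ← mul_assoc, ← ih, ← map_mul, ← hpe]
      exact hij
  rw [← hk, ← map_mul, ← hpR]

/-! ### Products that are framed by idempotents -/

namespace FreeProfinite

variable {A : Type} {H : SemigroupClass} {S : Type} [Semigroup S] [Finite S] [Nonempty S]

/-- The `ω`-power of a pseudoword. -/
noncomputable def omega (u : FreeProfinite A) : FreeProfinite A := omegaOp.subst fun _ => u

theorem evalHom_omega (f : A → S) (u : FreeProfinite A) :
    evalHom f (omega u) = omegaPow (evalHom f u) := rfl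

theorem jle_evalHom (f : A → S) {u : FreeProfinite A} {a : A}
    (ha : a ∈ content (u : WithOne (FreeProfinite A))) : JLE (evalHom f u) (f a) := by
  have h := congrArg (evalOne f) (leftPart_mul_rightPart true ha)
  rw [map_mul, map_mul] at h
  exact ⟨_, _, h.symm⟩

theorem jle_omegaPow (f : A → S) {u : FreeProfinite A} {a : A}
    (ha : a ∈ content (u : WithOne (FreeProfinite A))) :
    JLE (omegaPow (evalHom f u)) (f a) := by
  obtain ⟨n, hn⟩ := (omegaPow_spec (evalHom f u)).2
  rw [hn]
  exact (jle_powSucc _ n).trans (jle_evalHom f ha)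

variable [Finite A]

theorem jle_evalHom_of_content_subset (hS : classDO S) {f : A → S} {e : S} (he : e * e = e)
    {u : FreeProfinite A} (h : ∀ a ∈ content (u : WithOne (FreeProfinite A)), JLE e (f a)) :
    JLE e (evalHom f u) := by
  classical
  let T : Subsemigroup S :=
    { carrier := {x | JLE e x}
      mul_mem' := fun hx hy => hS.jle_mul he hx hy }
  -- Letters outside the content may be sent to `e`, so that all letter values lie in `T`.
  rw [evalHom_congr (g := fun a => if a ∈ content (u : WithOne (FreeProfinite A)) then f a else e)
    fun a ha => (if_pos ha).symm]
  refine evalHom_mem (T := T) (fun a => ?_) u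
  split_ifs with ha
  · exact h a ha
  · exact JLE.refl e

theorem jle_omegaPow_omegaPow (hS : classDO S) (f : A → S) {u v : FreeProfinite A}
    (h : content (v : WithOne (FreeProfinite A)) ⊆ content (u : WithOne (FreeProfinite A))) :
    JLE (omegaPow (evalHom f u)) (omegaPow (evalHom f v)) := by
  have he := (omegaPow_spec (evalHom f u)).1
  obtain ⟨n, hn⟩ := (omegaPow_spec (evalHom f v)).2
  rw [hn]
  have hv : JLE (omegaPow (evalHom f u)) (evalHom f v) :=
    jle_evalHom_of_content_subset hS he fun a ha => jle_omegaPow f (h ha)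
  clear hn
  induction n with
  | zero => exact hv
  | succ n ih => exact hS.jle_mul he ih hv

/-- On the subsemigroup `T` of elements `J`-above `e`, the map `ρ : x ↦ e x e` is a homomorphism
into a group `G`. As a subgroup of `S`, `G` is in `H`, where `t` and `t'` cannot be distinguished.
-/
theorem idem_mul_evalHom_mul_idem (hS : classDOBar H S) {f : A → S} {e : S} (he : e * e = e)
    {t t' : FreeProfinite A} (htt' : AgreeOn H (t : WithOne (FreeProfinite A)) t')
    (ht : ∀ a ∈ content (t : WithOne (FreeProfinite A)), JLE e (f a))
    (ht' : ∀ a ∈ content (t' : WithOne (FreeProfinite A)), JLE e (f a)) :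
    e * evalHom f t * e = e * evalHom f t' * e := by
  classical
  let T : Subsemigroup S :=
    { carrier := {x | JLE e x}
      mul_mem' := fun hx hy => hS.1.jle_mul he hx hy }
  let G : Subsemigroup S :=
    { carrier := {x | e * x = x ∧ x * e = x ∧ JLE e x}
      mul_mem' := fun {x y} hx hy =>
        ⟨by rw [← mul_assoc, hx.1], by rw [mul_assoc, hy.2.1], hS.1.jle_mul he hx.2.2 hy.2.2⟩ }
  have : Nonempty T := ⟨⟨e, JLE.refl e⟩⟩
  have : Nonempty G := ⟨⟨e, he, he, JLE.refl e⟩⟩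
  have hG : H G := by
    refine hS.2 G ⟨⟨e, he, he, JLE.refl e⟩, fun x => ⟨Subtype.ext x.2.1, Subtype.ext x.2.2.1⟩, ?_⟩
    rintro ⟨x, hx1, hx2, hx3⟩
    have hxJ : x ∈ jClass e := ⟨hx3, by rw [← hx1]; exact jle_mul_left _ _⟩
    obtain ⟨y, hy1, hy2, hy3, hy4⟩ := hS.1.exists_inv_of_mem he hxJ
    rw [hx1, hx2] at hy3 hy4
    exact ⟨⟨y, hy1, hy2, by nth_rw 1 [← hy3]; exact jle_mul_right _ _⟩,
      Subtype.ext hy3, Subtype.ext hy4⟩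
  let ρ : T →ₙ* G :=
    { toFun := fun x => ⟨e * x * e, by simp only [← mul_assoc, he], by simp only [mul_assoc, he],
        hS.1.jle_mul he (hS.1.jle_mul he (JLE.refl e) x.2) (JLE.refl e)⟩
      map_mul' := fun x y => Subtype.ext <| by
        change e * (x * y : S) * e = e * x * e * (e * y * e)
        calc e * (x * y : S) * e = e * x * (y * e) := by simp only [mul_assoc]
          _ = e * x * e * (y * e) := (hS.1.mul_idem_mul he (hS.1.idem_mul_mem he x.2).1
              (hS.1.idem_mul_mem he y.2).2).symm
          _ = e * x * (e * e) * (y * e) := by rw [he]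
          _ = _ := by simp only [mul_assoc] }
  let F : A → T := fun a => if ha : JLE e (f a) then ⟨f a, ha⟩ else ⟨e, JLE.refl e⟩
  have hF : ∀ s : FreeProfinite A, (∀ a ∈ content (s : WithOne (FreeProfinite A)), JLE e (f a)) →
      e * evalHom f s * e = (evalHom (fun a => ρ (F a)) s : S) := by
    intro s hs
    rw [← map_evalHom ρ F s]
    change _ = e * MulMemClass.subtype T (evalHom F s) * e
    rw [map_evalHom]
    congr 2
    refine evalHom_congr fun a ha => ?_
    simp only [F, dif_pos (hs a ha)]
    rfl
  rw [hF t ht, hF t' ht', htt'.evalHom_eq hG]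

/-- Framed by `ω`-powers of the same content, the values of pseudowords which agree on `H`
coincide. -/
theorem omegaPow_mul_evalHom_mul_omegaPow (hS : classDOBar H S) (f : A → S)
    {u v t t' : FreeProfinite A} (htt' : AgreeOn H (t : WithOne (FreeProfinite A)) t')
    (huv : content (v : WithOne (FreeProfinite A)) = content (u : WithOne (FreeProfinite A)))
    (ht : content (t : WithOne (FreeProfinite A)) ⊆ content (u : WithOne (FreeProfinite A)))
    (ht' : content (t' : WithOne (FreeProfinite A)) ⊆ content (u : WithOne (FreeProfinite A))) :
    omegaPow (evalHom f u) * evalHom f t * omegaPow (evalHom f v) =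
      omegaPow (evalHom f u) * evalHom f t' * omegaPow (evalHom f v) := by
  set e := omegaPow (evalHom f u) with he_def
  have he : e * e = e := (omegaPow_spec (evalHom f u)).1
  have hv : omegaPow (evalHom f v) ∈ jClass e :=
    ⟨jle_omegaPow_omegaPow hS.1 f huv.subset, jle_omegaPow_omegaPow hS.1 f huv.symm.subset⟩
  have hle : ∀ s : FreeProfinite A, content (s : WithOne (FreeProfinite A)) ⊆
      content (u : WithOne (FreeProfinite A)) → ∀ a ∈ content (s : WithOne (FreeProfinite A)),
      JLE e (f a) := fun s hs a ha => jle_omegaPow f (hs ha)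
  -- Both `ω`-powers lie in one regular `J`-class, so `e` can be inserted before the second, which
  -- reduces to a frame with `e` on both sides.
  have key : ∀ s : FreeProfinite A, content (s : WithOne (FreeProfinite A)) ⊆
      content (u : WithOne (FreeProfinite A)) →
      e * evalHom f s * omegaPow (evalHom f v) =
        e * evalHom f s * e * omegaPow (evalHom f v) := fun s hs =>
    (hS.1.mul_idem_mul he (hS.1.idem_mul_mem he
      (jle_evalHom_of_content_subset hS.1 he (hle s hs))).1 hv).symm
  rw [key t ht, key t' ht', idem_mul_evalHom_mul_idem hS he htt' (hle t ht) (hle t' ht')]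

theorem AgreeOn.omega_mul_mul_omega (hH : IsPseudovariety H) {u u' v v' : FreeProfinite A}
    {t t' : WithOne (FreeProfinite A)}
    (hu : AgreeOn (classDOBar H) (u : WithOne (FreeProfinite A)) u')
    (hv : AgreeOn (classDOBar H) (v : WithOne (FreeProfinite A)) v')
    (htt' : AgreeOn H t t')
    (huv : content (v : WithOne (FreeProfinite A)) = content (u : WithOne (FreeProfinite A)))
    (ht : content t ⊆ content (u : WithOne (FreeProfinite A)))
    (ht' : content t' ⊆ content (u : WithOne (FreeProfinite A))) :
    AgreeOn (classDOBar H) (WithOne.coe (omega u) * t * WithOne.coe (omega v))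
      (WithOne.coe (omega u') * t' * WithOne.coe (omega v')) := by
  intro T _ _ _ hT f
  simp only [map_mul, evalOne_coe, evalHom_omega, ← hu.evalHom_eq hT, ← hv.evalHom_eq hT]
  induction t with
  | one =>
    induction t' with
    | one => rfl
    | coe t' => exact absurd (htt' PUnit hH.unit fun _ => PUnit.unit).symm WithOne.coe_ne_one
  | coe t =>
    induction t' with
    | one => exact absurd (htt' PUnit hH.unit fun _ => PUnit.unit) WithOne.coe_ne_one
    | coe t' =>
      exact congrArg WithOne.coe (omegaPow_mul_evalHom_mul_omegaPow hT f htt' huv ht ht')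

end FreeProfinite

namespace FreeProfinite

variable {A : Type}

/-! ### Terms -/

theorem _root_.ImplicitSignature.IsTerm.mul {σ : ImplicitSignature} {u v : FreeProfinite A}
    (hu : σ.IsTerm u) (hv : σ.IsTerm v) : σ.IsTerm (u * v) :=
  ImplicitSignature.IsTerm.op (of 0 * of 1) σ.mul_mem ![u, v] fun i => by
    fin_cases i
    · exact hu
    · exact hv

theorem _root_.ImplicitSignature.IsTerm.adjoinOmega {σ : ImplicitSignature} {u : FreeProfinite A}
    (hu : σ.IsTerm u) : σ.adjoinOmega.IsTerm u := by
  induction hu with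
  | of a => exact ImplicitSignature.IsTerm.of a
  | op w hw v _ ih => exact ImplicitSignature.IsTerm.op (σ := σ.adjoinOmega) w (Or.inl hw) v ih

theorem _root_.ImplicitSignature.IsTerm.omega {σ : ImplicitSignature} {u : FreeProfinite A}
    (hu : σ.adjoinOmega.IsTerm u) : σ.adjoinOmega.IsTerm (omega u) :=
  ImplicitSignature.IsTerm.op (σ := σ.adjoinOmega) omegaOp (Or.inr rfl) (fun _ => u) fun _ => hu

/-- The possibly empty pseudowords that are terms over `σ` when they are not empty. -/
def termSubmonoid (σ : ImplicitSignature) (A : Type) : Submonoid (WithOne (FreeProfinite A)) where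
  carrier := {x | ∀ u : FreeProfinite A, x = u → σ.IsTerm u}
  one_mem' := fun _ h => absurd h.symm WithOne.coe_ne_one
  mul_mem' := by
    intro x y hx hy w hw
    cases x with
    | one => exact hy w (by rw [← hw, one_mul])
    | coe u =>
      cases y with
      | one => exact hx w (by rw [← hw, mul_one])
      | coe v =>
        rw [← WithOne.coe_mul, WithOne.coe_inj] at hw
        exact hw ▸ (hx u rfl).mul (hy v rfl)

theorem coe_mem_termSubmonoid {σ : ImplicitSignature} {u : FreeProfinite A} :
    (u : WithOne (FreeProfinite A)) ∈ termSubmonoid σ A ↔ σ.IsTerm u :=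
  ⟨fun h => h u rfl, fun h _ hv => WithOne.coe_injective hv ▸ h⟩

/-! ### Families of pseudowords that can be replaced by terms -/

variable {S : Type} [Semigroup S] [Finite S] [Nonempty S] {I : Type}

/-- There is a family of terms over `σ` (possibly empty) which has the same values under `g` as
the family `u` and whose members agree on `V`. -/
def Replaceable (V : SemigroupClass) (σ : ImplicitSignature) (g : A → S)
    (u : I → WithOne (FreeProfinite A)) : Prop :=
  ∃ w : I → WithOne (FreeProfinite A), (∀ i j, AgreeOn V (w i) (w j)) ∧
    (∀ i, w i ∈ termSubmonoid σ A) ∧ ∀ i, evalOne g (w i) = evalOne g (u i)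

namespace Replaceable

variable {V : SemigroupClass} {σ : ImplicitSignature} {g : A → S}
  {u v : I → WithOne (FreeProfinite A)}

theorem congr (h : Replaceable V σ g u) (huv : ∀ i, evalOne g (u i) = evalOne g (v i)) :
    Replaceable V σ g v := by
  obtain ⟨w, h1, h2, h3⟩ := h
  exact ⟨w, h1, h2, fun i => (h3 i).trans (huv i)⟩

theorem one : Replaceable V σ g (1 : I → WithOne (FreeProfinite A)) :=
  ⟨1, fun _ _ _ _ _ _ _ _ => rfl, fun _ => one_mem _, fun _ => rfl⟩

theorem letter (a : A) : Replaceable V σ g fun _ : I => (of a : WithOne (FreeProfinite A)) :=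
  ⟨fun _ => of a, fun _ _ _ _ _ _ _ _ => rfl,
    fun _ => coe_mem_termSubmonoid.2 (ImplicitSignature.IsTerm.of a), fun _ => rfl⟩

theorem mul (hu : Replaceable V σ g u) (hv : Replaceable V σ g v) :
    Replaceable V σ g (u * v) := by
  obtain ⟨w, h1, h2, h3⟩ := hu
  obtain ⟨w', h1', h2', h3'⟩ := hv
  refine ⟨w * w', fun i j => (h1 i j).mul (h1' i j), fun i => mul_mem (h2 i) (h2' i), fun i => ?_⟩
  rw [Pi.mul_apply, Pi.mul_apply, map_mul, map_mul, h3, h3']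

end Replaceable

theorem AgreeOn.mono {V W : SemigroupClass}
    (hVW : ∀ (S : Type) [Semigroup S] [Finite S] [Nonempty S], V S → W S)
    {x y : WithOne (FreeProfinite A)} (h : AgreeOn W x y) : AgreeOn V x y :=
  fun S _ _ _ hS => h S (hVW S hS)

/-- The values of an agreeing family form an `H`-pointlike set, for which reducibility supplies
terms. Empty pseudowords are separated off, since agreement over the trivial semigroup makes all
members empty or none. -/
theorem replaceable_of_isReducibleForPointlikes [Finite A] {H : SemigroupClass} (hH : H PUnit)
    {σ : ImplicitSignature} (hσ : IsReducibleForPointlikes H σ) {g : A → S}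
    (hg : Function.Surjective (evalHom g)) {z : I → WithOne (FreeProfinite A)}
    (hz : ∀ i j, AgreeOn H (z i) (z j)) : Replaceable H σ g z := by
  cases isEmpty_or_nonempty I with
  | inl _ => exact ⟨1, isEmptyElim, isEmptyElim, isEmptyElim⟩
  | inr hI =>
    obtain ⟨i₀⟩ := hI
    by_cases h1 : z i₀ = 1
    · refine Replaceable.one.congr fun i => ?_
      have := hz i₀ i PUnit hH fun _ => PUnit.unit
      rw [h1] at this
      cases hi : z i with
      | one => rfl
      | coe v => rw [hi] at this; exact absurd this.symm WithOne.coe_ne_one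
    · have hne : ∀ i, z i ≠ 1 := by
        intro i hi
        have := hz i i₀ PUnit hH fun _ => PUnit.unit
        rw [hi] at this
        cases h0 : z i₀ with
        | one => exact h1 h0
        | coe v => rw [h0] at this; exact WithOne.coe_ne_one this.symm
      choose v hv using fun i => WithOne.ne_one_iff_exists.1 (hne i)
      obtain rfl : (fun i => (v i : WithOne (FreeProfinite A))) = z := funext hv
      have hP : IsPointlikeWitness H (evalHom g) (Set.range fun i => evalHom g (v i))
          (Set.range v) := by
        refine ⟨(Set.range_comp (evalHom g) v).symm, proj H (v i₀),
          Set.eq_singleton_iff_unique_mem.2 ⟨⟨_, ⟨i₀, rfl⟩, rfl⟩, ?_⟩⟩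
        rintro _ ⟨_, ⟨i, rfl⟩, rfl⟩
        exact (hz i i₀).proj_eq
      obtain ⟨P', hP', hP1, q, hq⟩ := hσ S _ (isPointlike_of_witness hP) A (evalHom g)
        (continuous_evalHom g) hg
      have ht : ∀ i, ∃ t ∈ P', evalHom g t = evalHom g (v i) := fun i => by
        have : evalHom g (v i) ∈ evalHom g '' P' := hP1 ▸ ⟨i, rfl⟩
        exact this
      choose t ht1 ht2 using ht
      have hproj : ∀ i, proj H (t i) = q := fun i => by
        have : proj H (t i) ∈ proj H '' P' := ⟨_, ht1 i, rfl⟩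
        rwa [hq, Set.mem_singleton_iff] at this
      exact ⟨fun i => t i, fun i j => AgreeOn.of_proj_eq ((hproj i).trans (hproj j).symm),
        fun i => coe_mem_termSubmonoid.2 (hP' (ht1 i)), fun i => congrArg WithOne.coe (ht2 i)⟩

/-- The families of pseudowords over `B` whose members agree on `V`. -/
def agreeingFamilies (V : SemigroupClass) (I : Type) (B : Set A) :
    Submonoid (I → WithOne (FreeProfinite A)) where
  carrier := {u | (∀ i j, AgreeOn V (u i) (u j)) ∧ ∀ i, content (u i) ⊆ B}
  one_mem' := ⟨fun _ _ _ _ _ _ _ _ => rfl, fun _ => content_one.subset.trans (Set.empty_subset _)⟩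
  mul_mem' := fun hu hv => ⟨fun i j => (hu.1 i j).mul (hv.1 i j), fun i => by
    rw [Pi.mul_apply, content_mul]; exact Set.union_subset (hu.2 i) (hv.2 i)⟩

/-! ### The induction on the content. -/

section Main

variable {H : SemigroupClass}

theorem classDOBar_withOne_punit (hH : IsGroupPseudovariety H) :
    classDOBar H (WithOne PUnit) :=
  (classDOBar_of_mem hH hH.isPseudovariety.unit).withOne hH

/-- A family of possibly empty pseudowords in which a letter occurs can be cut at that letter. -/
theorem exists_cut_family (hH : IsGroupPseudovariety H) {B : Set A} {a : A}
    (u : agreeingFamilies (classDOBar H) I B) (ha : ∀ i, a ∈ content (u.1 i)) (first : Bool) :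
    ∃ x b y : agreeingFamilies (classDOBar H) I B, u = x * b * y ∧
      b.1 = (fun _ => WithOne.coe (of a)) ∧ (first = true → ∀ i, a ∉ content (x.1 i)) ∧
      (first = false → ∀ i, a ∉ content (y.1 i)) := by
  obtain ⟨u, hu, huB⟩ := u
  have hcut : ∀ i, leftPart first a (u i) * of a * rightPart first a (u i) = u i :=
    fun i => leftPart_mul_rightPart first (ha i)
  have hcont : ∀ i, content (leftPart first a (u i)) ∪ {a} ∪ content (rightPart first a (u i)) ⊆
      B := fun i => by
    rw [← content_of, ← content_mul, ← content_mul, hcut]; exact huB i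
  refine ⟨⟨fun i => leftPart first a (u i), fun i j => (hu i j).leftPart hH first a,
      fun i => (Set.subset_union_left.trans Set.subset_union_left).trans (hcont i)⟩,
    ⟨fun _ => WithOne.coe (of a), fun _ _ _ _ _ _ _ _ => rfl, fun i => by
      rw [content_of]
      exact (Set.subset_union_right.trans Set.subset_union_left).trans (hcont i)⟩,
    ⟨fun i => rightPart first a (u i), fun i j => (hu i j).rightPart hH first a,
      fun i => Set.subset_union_right.trans (hcont i)⟩,
    Subtype.ext (funext fun i => (hcut i).symm), rfl, ?_, ?_⟩
  · rintro rfl i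
    exact notMem_content_leftPart a _
  · rintro rfl i
    exact notMem_content_rightPart a _

/-- Replacement of the pieces of a family of factorizations `p e^k z f^l q`, in which the values of
high powers `e^k` and `f^l` can be inserted. -/
theorem replaceable_of_factor_pow [Finite A] (hH : IsGroupPseudovariety H) {σ : ImplicitSignature}
    {g : A → S} (hg : ∀ x y : WithOne (FreeProfinite A), evalOne g x = evalOne g y →
      content x = content y) {B : Set A} (hB : B.Nonempty)
    {u p e z f q : I → WithOne (FreeProfinite A)}
    (hp : Replaceable (classDOBar H) σ.adjoinOmega g p)
    (he : Replaceable (classDOBar H) σ.adjoinOmega g e)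
    (hz : Replaceable H σ g z)
    (hf : Replaceable (classDOBar H) σ.adjoinOmega g f)
    (hq : Replaceable (classDOBar H) σ.adjoinOmega g q)
    (hec : ∀ i, content (e i) = B) (hfc : ∀ i, content (f i) = B) (hzc : ∀ i, content (z i) ⊆ B)
    (hu : ∀ i, ∀ k l : ℕ, evalOne g (u i) = evalOne g (p i) * evalOne g (e i) ^ k *
      evalOne g (z i) * evalOne g (f i) ^ l * evalOne g (q i)) :
    Replaceable (classDOBar H) σ.adjoinOmega g u := by
  obtain ⟨p', hp1, hp2, hp3⟩ := hp
  obtain ⟨q', hq1, hq2, hq3⟩ := hq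
  obtain ⟨t, ht1, ht2, ht3⟩ := hz
  have key : ∀ e : I → WithOne (FreeProfinite A), Replaceable (classDOBar H) σ.adjoinOmega g e →
      (∀ i, content (e i) = B) → ∃ e' : I → FreeProfinite A,
        (∀ i j, AgreeOn (classDOBar H) (e' i : WithOne (FreeProfinite A)) (e' j)) ∧
        (∀ i, σ.adjoinOmega.IsTerm (e' i)) ∧
        (∀ i, content (e' i : WithOne (FreeProfinite A)) = B) ∧
        ∀ i, ∃ k, evalOne g (omega (e' i) : WithOne (FreeProfinite A)) = evalOne g (e i) ^ k := by
    rintro e ⟨w, h1, h2, h3⟩ hec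
    -- The value under `g` determines the content, so replacement preserves it; in particular the
    -- replaced factors are not empty.
    have hwc : ∀ i, content (w i) = B := fun i => (hg _ _ (h3 i)).trans (hec i)
    have hne : ∀ i, w i ≠ 1 := fun i hi => by
      have := hwc i
      rw [hi, content_one] at this
      exact hB.ne_empty this.symm
    choose e' he' using fun i => WithOne.ne_one_iff_exists.1 (hne i)
    obtain rfl : (fun i => (e' i : WithOne (FreeProfinite A))) = w := funext he'
    refine ⟨e', h1, fun i => coe_mem_termSubmonoid.1 (h2 i), hwc, fun i => ?_⟩
    obtain ⟨n, hn⟩ := (omegaPow_spec (evalHom g (e' i))).2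
    refine ⟨n + 1, ?_⟩
    rw [← h3, evalOne_coe, evalHom_omega, hn, coe_powSucc, evalOne_coe]
  obtain ⟨e', he1, he2, he3, he4⟩ := key e he hec
  obtain ⟨f', hf1, hf2, hf3, hf4⟩ := key f hf hfc
  have htc : ∀ i, content (t i) ⊆ B := fun i => (hg _ _ (ht3 i)).subset.trans (hzc i)
  refine ⟨fun i => p' i * (WithOne.coe (omega (e' i)) * t i * WithOne.coe (omega (f' i))) * q' i,
    fun i j => ?_, fun i => ?_, fun i => ?_⟩
  · refine ((hp1 i j).mul ?_).mul (hq1 i j)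
    exact AgreeOn.omega_mul_mul_omega hH.isPseudovariety (he1 i j) (hf1 i j) (ht1 i j)
      (by rw [he3, hf3]) (by rw [he3]; exact htc i) (by rw [he3]; exact htc j)
  · refine mul_mem (mul_mem (hp2 i) (mul_mem (mul_mem ?_ ?_) ?_)) (hq2 i)
    · exact coe_mem_termSubmonoid.2 (he2 i).omega
    · exact fun v hv => (ht2 i v hv).adjoinOmega
    · exact coe_mem_termSubmonoid.2 (hf2 i).omega
  · obtain ⟨k, hk⟩ := he4 i
    obtain ⟨l, hl⟩ := hf4 i
    simp only [map_mul, hp3, hq3, hk, hl, ht3, hu i k l, mul_assoc]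

/-- Replaceable families form a submonoid `G`, containing by induction every agreeing family that
misses a letter of `B`. Cutting at first and last occurrences then provides the hypotheses of
`exists_factor_pow`. Finiteness of `I` makes the monoid of value families finite; `i₀` serves to
read off the common content. -/
theorem replaceable_of_agreeOn [Finite A] [Finite I] (hH : IsGroupPseudovariety H)
    {σ : ImplicitSignature} (hσ : IsReducibleForPointlikes H σ) {g : A → S}
    (hsurj : Function.Surjective (evalHom g))
    (hg : ∀ x y : WithOne (FreeProfinite A), evalOne g x = evalOne g y → content x = content y)
    (i₀ : I) (B : Finset A) (u : I → WithOne (FreeProfinite A))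
    (hu : u ∈ agreeingFamilies (classDOBar H) I (B : Set A)) :
    Replaceable (classDOBar H) σ.adjoinOmega g u := by
  classical
  induction B using Finset.strongInduction generalizing u with
  | H B ih =>
  have hcont : ∀ v ∈ agreeingFamilies (classDOBar H) I (B : Set A), ∀ i,
      content (v i) = content (v i₀) := fun v hv i =>
    (hv.1 i i₀).content_eq (classDOBar_withOne_punit hH)
  have hsmall : ∀ v ∈ agreeingFamilies (classDOBar H) I (B : Set A), ∀ b ∈ B,
      b ∉ content (v i₀) → Replaceable (classDOBar H) σ.adjoinOmega g v := by
    intro v hv b hb hbv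
    refine ih (B.erase b) (Finset.erase_ssubset hb) v ⟨hv.1, fun i a ha => ?_⟩
    rw [Finset.coe_erase]
    refine ⟨hv.2 i ha, ?_⟩
    rintro rfl
    exact hbv (hcont v hv i ▸ ha)
  rcases B.eq_empty_or_nonempty with rfl | hB
  · refine Replaceable.one.congr fun i => ?_
    have hi := hu.2 i
    cases h : u i with
    | one => rfl
    | coe v =>
      rw [h] at hi
      obtain ⟨a, ha⟩ := content_coe_nonempty v
      exact absurd (hi ha) (by simp)
  let F := agreeingFamilies (classDOBar H) I (B : Set A)
  let G : Submonoid F :=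
    { carrier := {v | Replaceable (classDOBar H) σ.adjoinOmega g v.1}
      one_mem' := Replaceable.one
      mul_mem' := Replaceable.mul }
  let Φ : F →* (I → WithOne S) :=
    { toFun := fun v i => evalOne g (v.1 i)
      map_one' := rfl
      map_mul' := fun v w => funext fun i => map_mul _ _ _ }
  have hG : ∀ v : F, v ∈ G ↔ Replaceable (classDOBar H) σ.adjoinOmega g v.1 := fun _ => Iff.rfl
  have hletter : ∀ (b : F) (a : A), b.1 = (fun _ => (of a : WithOne (FreeProfinite A))) →
      b ∈ G ∧ a ∈ content (b.1 i₀) := by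
    intro b a hb
    rw [hG, hb, content_of]
    exact ⟨Replaceable.letter a, rfl⟩
  have hleft := exists_factor_pow Φ G (fun v => content (v.1 i₀))
    (fun x y => content_mul _ _) B fun v b hb => by
      by_cases hbv : b ∈ content (v.1 i₀)
      · obtain ⟨x, β, y, rfl, hβ, hx, -⟩ := exists_cut_family hH v
          (fun i => (hcont v.1 v.2 i).symm ▸ hbv) true
        obtain ⟨hβG, hβc⟩ := hletter β b hβ
        refine Or.inr ⟨x * β, y, rfl, G.mul_mem (hsmall _ x.2 b hb (hx rfl i₀)) hβG, ?_⟩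
        exact (content_mul (x.1 i₀) (β.1 i₀)).symm ▸ Or.inr hβc
      · exact Or.inl (hsmall _ v.2 b hb hbv)
  have : Finite (I → WithOne S)ᵐᵒᵖ := Finite.of_equiv _ MulOpposite.opEquiv
  -- Splitting off suffixes is splitting off prefixes in the opposite monoid, now with cuts at last
  -- occurrences.
  have hright := exists_factor_pow Φ.op G.op (fun v => content (v.unop.1 i₀))
    (fun x y => (content_mul _ _).trans (Set.union_comm _ _)) B fun v b hb => by
      by_cases hbv : b ∈ content (v.unop.1 i₀)
      · obtain ⟨x, β, y, hv, hβ, -, hy⟩ := exists_cut_family hH v.unop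
          (fun i => (hcont v.unop.1 v.unop.2 i).symm ▸ hbv) false
        obtain ⟨hβG, hβc⟩ := hletter β b hβ
        refine Or.inr ⟨MulOpposite.op (β * y), MulOpposite.op x, ?_,
          G.mul_mem hβG (hsmall _ y.2 b hb (hy rfl i₀)), ?_⟩
        · rw [← MulOpposite.op_mul, ← mul_assoc, ← hv, MulOpposite.op_unop]
        · exact (content_mul (β.1 i₀) (y.1 i₀)).symm ▸ Or.inl hβc
      · exact Or.inl (hsmall _ v.unop.2 b hb hbv)
  rcases hleft ⟨u, hu⟩ with h | ⟨p, e, r, hp, he, hec, hpow⟩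
  · exact h
  rcases hright (MulOpposite.op r) with h | ⟨q, f, z, hq, hf, hfc, hpow'⟩
  · have h1 := G.mul_mem (G.mul_mem hp he) h
    refine Replaceable.congr ((hG _).1 h1) fun i => ?_
    have := congrFun (hpow 1) i
    rw [pow_one, ← map_mul, ← map_mul] at this
    exact this.symm
  · have hfull : ∀ v : F, (B : Set A) ⊆ content (v.1 i₀) → ∀ i, content (v.1 i) = B :=
      fun v hv i => (v.2.2 i).antisymm ((hcont v.1 v.2 i).symm ▸ hv)
    refine replaceable_of_factor_pow hH hg (B := B) hB (p := p.1) (e := e.1) (z := z.unop.1)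
      (f := f.unop.1) (q := q.unop.1) hp he ?_ hf hq (hfull e hec) (hfull f.unop hfc)
      z.unop.2.2 fun i k l => ?_
    -- Nothing is known about the middle `z` except agreement over `DO ∩ H̄`; as this class contains
    -- `H`, reducibility of `H` applies.
    · exact replaceable_of_isReducibleForPointlikes hH.isPseudovariety.unit hσ hsurj fun i j =>
        (z.unop.2.1 i j).mono fun S _ _ _ hS => classDOBar_of_mem hH hS
    · have h1 := congrFun (hpow k) i
      have h2 := congrFun (congrArg MulOpposite.unop (hpow' l)) i
      refine h1.trans ?_
      change evalOne g (p.1 i) * evalOne g (e.1 i) ^ k * evalOne g (r.1 i) = _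
      have h2 : evalOne g (r.1 i) = evalOne g (z.unop.1 i) * (evalOne g (f.unop.1 i) ^ l *
        evalOne g (q.unop.1 i)) := h2
      rw [h2]
      simp only [mul_assoc]

end Main

end FreeProfinite

open FreeProfinite in
theorem corollaryc (H : SemigroupClass) (hH : IsGroupPseudovariety H) (σ : ImplicitSignature)
    (hσ : IsReducibleForPointlikes H σ) :
    IsReducibleForPointlikes (classDOBar H) σ.adjoinOmega := by
  intro S _ _ _ P hP A _ φ hφ hsurj
  obtain ⟨P', rfl, q, hq⟩ := hP A φ hφ hsurj
  have hproj : ∀ v ∈ P', proj (classDOBar H) v = q := fun v hv => by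
    have : proj (classDOBar H) v ∈ proj (classDOBar H) '' P' := ⟨v, hv, rfl⟩
    rwa [hq, Set.mem_singleton_iff] at this
  obtain ⟨u₀, hu₀, -⟩ : q ∈ proj (classDOBar H) '' P' := hq ▸ rfl
  -- Adjoining the content to `φ` and restricting to the image gives a finite semigroup in which
  -- values determine contents.
  let ψ : FreeProfinite A →ₙ* S × (A → WithOne PUnit.{1}) := φ.prod contentHom
  have : Nonempty ψ.srange := ⟨ψ.srangeRestrict u₀⟩
  let g : A → ψ.srange := fun a => ψ.srangeRestrict (of a)
  have hgψ : ∀ u, evalHom g u = ψ.srangeRestrict u := by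
    intro u
    have h1 := map_evalHom ((MulHom.fst S (A → WithOne PUnit.{1})).comp
      (MulMemClass.subtype ψ.srange)) g u
    have h2 := map_evalHom ((MulHom.snd S (A → WithOne PUnit.{1})).comp
      (MulMemClass.subtype ψ.srange)) g u
    exact Subtype.ext (Prod.ext (h1.trans (apply_eq_evalHom hφ u).symm) h2)
  have hg : ∀ x y : WithOne (FreeProfinite A), evalOne g x = evalOne g y →
      content x = content y := by
    intro x y hxy
    cases x with
    | one =>
      cases y with
      | one => rfl
      | coe v => exact absurd hxy.symm WithOne.coe_ne_one
    | coe u =>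
      cases y with
      | one => exact absurd hxy WithOne.coe_ne_one
      | coe v =>
        have h1 : evalHom g u = evalHom g v := WithOne.coe_injective hxy
        rw [hgψ, hgψ] at h1
        have h2 : contentHom u = contentHom v := congrArg (fun s => s.1.2) h1
        ext a
        rw [mem_content_coe, mem_content_coe, h2]
  -- One pseudoword is kept for each element of the pointlike set, so the family is finite.
  choose u huP hu using fun s : φ '' P' => s.2
  cases nonempty_fintype A
  obtain ⟨w, hw1, hw2, hw3⟩ := replaceable_of_agreeOn hH hσ (g := g)
    (fun s => by
      obtain ⟨v, hv⟩ := ψ.srangeRestrict_surjective s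
      exact ⟨v, (hgψ v).trans hv⟩) hg (⟨φ u₀, u₀, hu₀, rfl⟩ : φ '' P') Finset.univ
    (fun s => (u s : WithOne (FreeProfinite A)))
    ⟨fun s t => AgreeOn.of_proj_eq ((hproj _ (huP s)).trans (hproj _ (huP t)).symm),
      fun s => by rw [Finset.coe_univ]; exact Set.subset_univ _⟩
  have hne : ∀ s, w s ≠ 1 := fun s hs => by
    have := hw3 s
    rw [hs] at this
    exact WithOne.coe_ne_one this.symm
  choose v hv using fun s => WithOne.ne_one_iff_exists.1 (hne s)
  obtain rfl : (fun s => (v s : WithOne (FreeProfinite A))) = w := funext hv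
  have hφv : ∀ s, φ (v s) = s := fun s => by
    have h1 : evalHom g (v s) = evalHom g (u s) := WithOne.coe_injective (hw3 s)
    rw [hgψ, hgψ] at h1
    exact (congrArg (fun s => s.1.1) h1).trans (hu s)
  refine ⟨Set.range v, ?_, ?_, proj _ (v ⟨φ u₀, u₀, hu₀, rfl⟩),
    Set.eq_singleton_iff_unique_mem.2 ⟨⟨_, ⟨_, rfl⟩, rfl⟩, ?_⟩⟩
  · rintro _ ⟨s, rfl⟩
    exact coe_mem_termSubmonoid.1 (hw2 s)
  · rw [← Set.range_comp]
    exact (congrArg Set.range (funext hφv)).trans Subtype.range_coe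
  · rintro _ ⟨_, ⟨s, rfl⟩, rfl⟩
    exact (hw1 s _).proj_eq
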